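/- Let $r\colon \mathbb{N}\to\mathbb{N}$ be a function such that, for all sufficiently large $n$, $$2 \le r(n) \le \frac{\log n}{120\,\log\log n},$$ where $\log$ is the natural logarithm. Then almost all $K_{r(n)+1}$-free subgraphs of $K_n$ are $r(n)$-partite; that is, $$\lim_{n\to\infty} \frac{\bigl|\{G \subseteq K_n : G \text{ is } K_{r(n)+1}\text{-free and not } r(n)\text{-partite}\}\bigr|}{\bigl|\{G \subseteq K_n : G \text{ is } K_{r(n)+1}\text{-free}\}\bigr|} = 0 .$$ Here the graphs $G\subseteq K_n$ are the labelled graphs on a fixed set of $n$ vertices, $G$ is $K_{s}$-free if it contains no $s$ pairwise adjacent vertices, and $G$ is $r$-partite if its vertex set can be partitioned into $r$ (possibly empty) independent sets. -/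

import Mathlib

/-- The labelled `K_{r+1}`-free graphs on `n` vertices, i.e. the `K_{r+1}`-free (spanning)
subgraphs of `K_n`. -/
def cliqueFreeGraphs (n r : ℕ) : Set (SimpleGraph (Fin n)) :=
  {G | G.CliqueFree (r + 1)}

/-- The `K_{r+1}`-free subgraphs of `K_n` that are not `r`-partite; a graph is `r`-partite if its
vertices can be partitioned into `r` (possibly empty) independent sets. -/
def nonPartiteCliqueFreeGraphs (n r : ℕ) : Set (SimpleGraph (Fin n)) :=
  {G | G.CliqueFree (r + 1) ∧ ¬ G.Colorable r}

/-! The count is governed by an integer L with m + 1 ≤ 2^L and L^(24 + 28r) ≤ m, where m is the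
number of vertices. All error terms are powers of L, and the upper bound on r is what allows such an
L to be chosen.

Containers. Suppose the whole vertex set is (r+1)-rich in C, and G ≤ C is K_{r+1}-free. Passing
repeatedly to G-neighbourhoods that are rich in C would build a clique, so the descent stops
(`exists_rich_with_poor_nbrsIn`). It stops at a set W in which every G-neighbourhood is poor, while
many C-neighbourhoods are rich. At each such vertex G misses a large set taken from a short list
(`exists_family_disjoint_poor`). By pigeonhole, a good proportion of the graphs therefore lie below
C with these stars removed. Iterating gives `exists_poor_container_pow`: any family of K_{r+1}-free
graphs has, up to a factor 2^(m²/L^11), all its members below one poor graph. A full covering family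
of containers is not needed.

Stability. Füredi's argument, run with rich sets in place of cliques, shows that a poor graph is
nearly r-partite or has few edges (`exists_coloring_of_not_rich`). This bounds the number of
K_{r+1}-free graphs. Applied also with r - 1 in place of r, it shows that all but a tiny fraction
have a nice partition (`card_filter_forall_not_isNice_le`).

Recursion. In a nice K_{r+1}-free graph every vertex has few neighbours in some part. If the graph
is not r-colourable, an edge xy joins two vertices with the same such part i (`IsNice.exists_adj`).
Its ends also have few common neighbours in another part j (`IsNice.exists_card_inter_lt`). Once x
and y are deleted, their neighbourhoods thus have about 1 choice per vertex of part i, 3 per vertex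
of part j and 4 elsewhere. That is fewer than the growth in the number of r-partite graphs when two
vertices are added (`mul_numColorable_le`). So the ratio of bad to r-partite graphs shrinks
exponentially at each step (`numNonColorable_fin_le`), and about n/4 steps overcome the crude
initial bound (`ratio_le`). -/

section Development

open Finset
open scoped Classical

/-! ### Rich sets: a robust substitute for cliques -/

section Rich

variable {V : Type*}

/-- The neighbours of `u` in `F` that lie in `S`. -/
noncomputable def nbrsIn (F : SimpleGraph V) (u : V) (S : Finset V) : Finset V :=
  {x ∈ S | F.Adj u x}

/-- `S` is `t`-rich in `F` if at least `θ` of its vertices have a `(t - 1)`-rich neighbourhood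
inside `S`; every set is `0`-rich. -/
def Rich (F : SimpleGraph V) (θ : ℝ) : ℕ → Finset V → Prop
  | 0, _ => True
  | t + 1, S => θ ≤ (#{u ∈ S | Rich F θ t (nbrsIn F u S)} : ℝ)

/-- The number of ordered pairs of adjacent vertices. -/
noncomputable def adjPairs [Fintype V] (G : SimpleGraph V) : ℕ := #{p : V × V | G.Adj p.1 p.2}

lemma mem_nbrsIn {F : SimpleGraph V} {u x : V} {S : Finset V} :
    x ∈ nbrsIn F u S ↔ x ∈ S ∧ F.Adj u x := by
  simp [nbrsIn]

lemma nbrsIn_subset (F : SimpleGraph V) (u : V) (S : Finset V) : nbrsIn F u S ⊆ S :=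
  filter_subset _ _

lemma nbrsIn_mono {F G : SimpleGraph V} (h : F ≤ G) (u : V) {S T : Finset V} (hST : S ⊆ T) :
    nbrsIn F u S ⊆ nbrsIn G u T := by
  intro x hx
  rw [mem_nbrsIn] at hx ⊢
  exact ⟨hST hx.1, h hx.2⟩

lemma rich_succ {F : SimpleGraph V} {θ : ℝ} {t : ℕ} {S : Finset V} :
    Rich F θ (t + 1) S ↔ θ ≤ (#{u ∈ S | Rich F θ t (nbrsIn F u S)} : ℝ) := Iff.rfl

/-- There are at most `(N + 1) ^ k` subsets of size at most `k` of an `N`-element set. -/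
lemma card_filter_card_le [Fintype V] (k : ℕ) :
    #{T : Finset V | #T ≤ k} ≤ (Fintype.card V + 1) ^ k := by
  induction k with
  | zero => simp [filter_eq']
  | succ k ih =>
    have hsub : ({T : Finset V | #T ≤ k + 1} : Finset (Finset V)) ⊆
        ((univ : Finset (Option V)) ×ˢ ({T : Finset V | #T ≤ k} : Finset (Finset V))).image
          (fun p => p.1.elim p.2 (fun v => insert v p.2)) := by
      intro T hT
      rw [mem_filter] at hT
      rw [mem_image]
      rcases T.eq_empty_or_nonempty with rfl | ⟨v, hv⟩
      · exact ⟨(none, ∅), by simp, rfl⟩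
      · refine ⟨(some v, T.erase v), ?_, ?_⟩
        · simp only [mem_product, mem_univ, true_and, mem_filter]
          rw [card_erase_of_mem hv]
          omega
        · simp [insert_erase hv]
    calc _ ≤ _ := card_le_card hsub
      _ ≤ _ := card_image_le
      _ = (Fintype.card V + 1) * #{T : Finset V | #T ≤ k} := by
        rw [card_product, card_univ, Fintype.card_option]
      _ ≤ (Fintype.card V + 1) * (Fintype.card V + 1) ^ k := by gcongr
      _ = _ := by ring

/-- A small family of large subsets of a rich set `X`, such that each poor subset of `X` is disjoint
from a member of the family. -/
lemma exists_family_disjoint_poor [Fintype V] (F : SimpleGraph V) {θ θ' : ℝ} (t : ℕ) (X : Finset V)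
    (hX : Rich F θ t X) :
    ∃ 𝒟 : Finset (Finset V), #𝒟 ≤ (Fintype.card V + 1) ^ (⌊θ'⌋₊ + t) ∧
      (∀ D ∈ 𝒟, D ⊆ X ∧ θ - θ' ≤ #D) ∧
      ∀ S ⊆ X, ¬ Rich F θ' t S → ∃ D ∈ 𝒟, Disjoint D S := by
  induction t generalizing X with
  | zero => exact ⟨∅, by simp, by simp, fun S _ h => (h trivial).elim⟩
  | succ t ih =>
    set U : Finset V := {u ∈ X | Rich F θ t (nbrsIn F u X)} with hU
    have hUcard : θ ≤ (#U : ℝ) := hX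
    choose 𝒟 h1 h2 h3 using ih
    let 𝒜 : Finset (Finset V) :=
      (({T : Finset V | #T ≤ ⌊θ'⌋₊} : Finset (Finset V)).image (fun T => U \ T)).filter
        (fun D => θ - θ' ≤ #D)
    let 𝒷 : V → Finset (Finset V) := fun u =>
      if h : Rich F θ t (nbrsIn F u X) then 𝒟 (nbrsIn F u X) h else ∅
    have h𝒷 : ∀ u, #(𝒷 u) ≤ (Fintype.card V + 1) ^ (⌊θ'⌋₊ + t) := by
      intro u
      by_cases h : Rich F θ t (nbrsIn F u X)
      · simp only [𝒷, h, dite_true]; exact h1 _ _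
      · simp [𝒷, h]
    refine ⟨𝒜 ∪ univ.biUnion 𝒷, ?_, ?_, ?_⟩
    · have hA : #𝒜 ≤ (Fintype.card V + 1) ^ (⌊θ'⌋₊ + t) :=
        (card_filter_le _ _).trans (card_image_le.trans ((card_filter_card_le _).trans
          (Nat.pow_le_pow_right (by omega) (by omega))))
      have hB : #(univ.biUnion 𝒷) ≤ Fintype.card V * (Fintype.card V + 1) ^ (⌊θ'⌋₊ + t) := by
        rw [← card_univ]
        exact card_biUnion_le_card_mul _ _ _ (fun u _ => h𝒷 u)
      calc _ ≤ #𝒜 + #(univ.biUnion 𝒷) := card_union_le _ _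
        _ ≤ (Fintype.card V + 1) ^ (⌊θ'⌋₊ + t) +
            Fintype.card V * (Fintype.card V + 1) ^ (⌊θ'⌋₊ + t) := add_le_add hA hB
        _ = _ := by ring
    · intro D hD
      rcases mem_union.1 hD with hD | hD
      · rw [mem_filter, mem_image] at hD
        obtain ⟨⟨T, -, rfl⟩, h⟩ := hD
        exact ⟨sdiff_subset.trans (filter_subset _ _), h⟩
      · obtain ⟨u, -, hu⟩ := mem_biUnion.1 hD
        by_cases h : Rich F θ t (nbrsIn F u X)
        · simp only [𝒷, h, dite_true] at hu
          exact ⟨(h2 _ _ _ hu).1.trans (nbrsIn_subset _ _ _), (h2 _ _ _ hu).2⟩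
        · simp [𝒷, h] at hu
    · intro S hS hpoor
      rw [rich_succ, not_le] at hpoor
      -- If every witness in S stays rich inside S, then S has fewer than θ' witnesses, and U with
      -- them removed is described by a small set. Otherwise some witness u has a poor neighbourhood
      -- in S. A set from the list for u lies inside the neighbourhood of u, so avoiding the part of
      -- S there means avoiding S.
      by_cases hcase : ∀ u ∈ S ∩ U, Rich F θ' t (nbrsIn F u S)
      · have hle : #(S ∩ U) ≤ #{u ∈ S | Rich F θ' t (nbrsIn F u S)} := by
          refine card_le_card fun u hu => mem_filter.2 ⟨(mem_inter.1 hu).1, hcase u hu⟩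
        have hlt : (#(S ∩ U) : ℝ) < θ' := lt_of_le_of_lt (by exact_mod_cast hle) hpoor
        refine ⟨U \ (S ∩ U), mem_union_left _ (mem_filter.2 ⟨mem_image.2 ⟨S ∩ U, ?_, rfl⟩, ?_⟩), ?_⟩
        · rw [mem_filter]
          exact ⟨mem_univ _, Nat.le_floor hlt.le⟩
        · have := card_sdiff_add_card_eq_card (inter_subset_right : S ∩ U ⊆ U)
          have h' : (#(U \ (S ∩ U)) : ℝ) + #(S ∩ U) = #U := by exact_mod_cast this
          linarith
        · rw [disjoint_left]
          intro x hx hxS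
          rw [mem_sdiff] at hx
          exact hx.2 (mem_inter.2 ⟨hxS, hx.1⟩)
      · push Not at hcase
        obtain ⟨u, hu, hpu⟩ := hcase
        have hr : Rich F θ t (nbrsIn F u X) := (mem_filter.1 (mem_inter.1 hu).2).2
        obtain ⟨D, hD, hdis⟩ := h3 _ hr (nbrsIn F u S) (nbrsIn_mono le_rfl u hS) hpu
        refine ⟨D, mem_union_right _ (mem_biUnion.2 ⟨u, mem_univ _, ?_⟩), ?_⟩
        · simp only [𝒷, hr, dite_true]; exact hD
        · rw [disjoint_left] at hdis ⊢
          intro x hx hxS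
          exact hdis hx (mem_nbrsIn.2 ⟨hxS, (mem_nbrsIn.1 ((h2 _ _ _ hD).1 hx)).2⟩)

/-- In a set that is rich in `C` and contains no `t`-clique of `G`, one can find a rich subset in
which all `G`-neighbourhoods are poor in `C`. -/
lemma exists_rich_with_poor_nbrsIn (C G : SimpleGraph V) (θ : ℕ → ℝ) (hθ : ∀ t, 0 < θ t) (t : ℕ)
    (W : Finset V) (hrich : Rich C (θ (t + 1)) (t + 1) W)
    (hfree : G.CliqueFreeOn (W : Set V) (t + 1)) :
    ∃ s W', 1 ≤ s ∧ s ≤ t ∧ Rich C (θ (s + 1)) (s + 1) W' ∧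
      ∀ u ∈ W', ¬ Rich C (θ s) s (nbrsIn G u W') := by
  induction t generalizing W with
  | zero =>
    exfalso
    rw [rich_succ] at hrich
    have hpos : 0 < #{u ∈ W | Rich C (θ (0 + 1)) 0 (nbrsIn C u W)} := by
      exact_mod_cast (hθ _).trans_le hrich
    obtain ⟨u, hu⟩ := card_pos.1 hpos
    have huW := (mem_filter.1 hu).1
    refine hfree (t := {u}) (by simpa using huW) ?_
    simp
  | succ t ih =>
    -- Entering a G-neighbourhood lowers the richness level and the forbidden clique size together,
    -- so the descent must stop before level 1, where a single vertex is already the forbidden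
    -- clique.
    by_cases h : ∀ u ∈ W, ¬ Rich C (θ (t + 1)) (t + 1) (nbrsIn G u W)
    · exact ⟨t + 1, W, by omega, le_rfl, hrich, h⟩
    · push Not at h
      obtain ⟨u, hu, hru⟩ := h
      obtain ⟨s, W', h1, h2, h3, h4⟩ := ih _ hru (by
        intro K hK hclique
        have hadj : ∀ x ∈ K, G.Adj u x := fun x hx => (mem_nbrsIn.1 (hK hx)).2
        refine hfree (t := insert u K) ?_ (hclique.insert hadj)
        intro x hx
        rcases mem_insert.1 (mem_coe.1 hx) with rfl | hx
        · exact hu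
        · exact (mem_nbrsIn.1 (hK hx)).1)
      exact ⟨s, W', h1, by omega, h3, h4⟩

end Rich

/-! ### One container by repeated pigeonholing -/

section Container

/-- Pigeonhole principle: if every element of `s` is related to an element of `t`, then some element
of `t` is related to at least `#s / #t` elements of `s`. -/
lemma exists_card_le_mul_card_filter {α β : Type*} (s : Finset α) (t : Finset β) (p : α → β → Prop)
    [∀ b, DecidablePred fun a => p a b]
    (hs : s.Nonempty) (h : ∀ a ∈ s, ∃ b ∈ t, p a b) :
    ∃ b ∈ t, #s ≤ #t * #{a ∈ s | p a b} := by
  obtain ⟨a, ha⟩ := hs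
  obtain ⟨b₀, hb₀, -⟩ := h a ha
  obtain ⟨b, hb, hmax⟩ := exists_max_image t (fun b => #{a ∈ s | p a b}) ⟨b₀, hb₀⟩
  refine ⟨b, hb, ?_⟩
  calc #s ≤ #(t.biUnion fun b => {a ∈ s | p a b}) := by
        refine card_le_card fun a ha => ?_
        obtain ⟨b, hb, hab⟩ := h a ha
        exact mem_biUnion.2 ⟨b, hb, mem_filter.2 ⟨ha, hab⟩⟩
    _ ≤ #t * #{a ∈ s | p a b} := card_biUnion_le_card_mul _ _ _ hmax

variable {V : Type*}

lemma adjPairs_mono [Fintype V] {G H : SimpleGraph V} (h : G ≤ H) : adjPairs G ≤ adjPairs H :=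
  card_le_card fun p hp => by
    simp only [mem_filter, mem_univ, true_and] at hp ⊢
    exact h hp

lemma adjPairs_le_sq [Fintype V] (G : SimpleGraph V) : adjPairs G ≤ Fintype.card V ^ 2 := by
  refine (card_filter_le _ _).trans ?_
  rw [card_univ, Fintype.card_prod, sq]

/-- Removing from `C`, for each `u ∈ U`, the edges from `u` to `D u`. -/
def deleteStars (C : SimpleGraph V) (U : Finset V) (D : V → Finset V) : SimpleGraph V where
  Adj x y := C.Adj x y ∧ ¬ (x ∈ U ∧ y ∈ D x) ∧ ¬ (y ∈ U ∧ x ∈ D y)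
  symm := ⟨fun _ _ h => ⟨h.1.symm, h.2.2, h.2.1⟩⟩
  loopless := ⟨fun _ h => C.irrefl h.1⟩

lemma deleteStars_le (C : SimpleGraph V) (U : Finset V) (D : V → Finset V) :
    deleteStars C U D ≤ C := fun _ _ h => h.1

/-- Only the orientation (u, x) with u ∈ U and x ∈ D u is counted as lost. These pairs are distinct,
so edges with both ends in U need no correction. -/
lemma adjPairs_deleteStars_add_le [Fintype V] (C : SimpleGraph V) (U : Finset V) (D : V → Finset V)
    (hD : ∀ u ∈ U, ∀ x ∈ D u, C.Adj u x) :
    adjPairs (deleteStars C U D) + ∑ u ∈ U, #(D u) ≤ adjPairs C := by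
  have hcard : ∑ u ∈ U, #(D u) = #((U.sigma D).image fun p => (p.1, p.2)) := by
    rw [card_image_of_injective, card_sigma]
    rintro ⟨a, b⟩ ⟨c, d⟩ h
    simp only [Prod.mk.injEq] at h
    obtain ⟨rfl, rfl⟩ := h
    rfl
  rw [hcard, adjPairs, ← card_union_of_disjoint]
  · refine card_le_card (union_subset ?_ ?_)
    · intro p hp
      simp only [mem_filter, mem_univ, true_and] at hp ⊢
      exact hp.1
    · intro p hp
      simp only [mem_image, mem_sigma, Sigma.exists] at hp
      obtain ⟨u, x, ⟨hu, hx⟩, rfl⟩ := hp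
      simpa using hD u hu x hx
  · rw [disjoint_left]
    intro p hp hp'
    simp only [mem_image, mem_sigma, Sigma.exists] at hp'
    obtain ⟨u, x, ⟨hu, hx⟩, rfl⟩ := hp'
    simp only [mem_filter, mem_univ, true_and] at hp
    exact hp.2.1 ⟨hu, hx⟩

/-- If the vertex set is rich in `C`, then a good proportion of any family of clique-free subgraphs
of `C` consists of subgraphs of a single graph with substantially fewer edges than `C`. -/
lemma exists_lt_container [Fintype V] {r : ℕ} {θ : ℕ → ℝ} (hθ : ∀ t, 0 < θ t) (hθlt : ∀ t, θ t < θ (t + 1))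
    {a : ℝ} (ha : 0 ≤ a)
    (hcost : ∀ s u : ℕ, 1 ≤ s → s ≤ r → θ (s + 1) ≤ u → u ≤ Fintype.card V →
      ((r + 1) * 2 ^ Fintype.card V) * (((Fintype.card V + 1) ^ (⌊θ s⌋₊ + s)) ^ u : ℝ) ≤
        (2 : ℝ) ^ (a * (u * (θ (s + 1) - θ s))))
    (C : SimpleGraph V) (𝒢 : Finset (SimpleGraph V)) (hfree : ∀ G ∈ 𝒢, G.CliqueFree (r + 1))
    (hle : ∀ G ∈ 𝒢, G ≤ C) (hne : 𝒢.Nonempty) (hrich : Rich C (θ (r + 1)) (r + 1) univ) :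
    ∃ C' < C, (#𝒢 : ℝ) ≤ 2 ^ (a * ((adjPairs C : ℝ) - adjPairs C')) * #{G ∈ 𝒢 | G ≤ C'} := by
  -- Pigeonhole is used twice: over the level and set (s, W) where the descent stops, then over the
  -- missed sets D u for u ∈ U. The surviving graphs all omit the same stars.
  let p : SimpleGraph V → ℕ × Finset V → Prop := fun G q => 1 ≤ q.1 ∧
    Rich C (θ (q.1 + 1)) (q.1 + 1) q.2 ∧ ∀ u ∈ q.2, ¬ Rich C (θ q.1) q.1 (nbrsIn G u q.2)
  obtain ⟨⟨s, W⟩, hsW, hcard1⟩ := exists_card_le_mul_card_filter 𝒢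
    (range (r + 1) ×ˢ (univ : Finset (Finset V))) p hne (by
      intro G hG
      obtain ⟨s, W, h1, h2, h3, h4⟩ := exists_rich_with_poor_nbrsIn C G θ hθ r univ hrich
        ((hfree G hG).cliqueFreeOn)
      exact ⟨(s, W), by simp; omega, h1, h3, h4⟩)
  set 𝒢₁ : Finset (SimpleGraph V) := {G ∈ 𝒢 | p G (s, W)} with h𝒢₁
  have hne₁ : 𝒢₁.Nonempty := by
    rw [← card_pos]
    by_contra h
    have h0 : #𝒢₁ = 0 := by omega
    rw [h0, mul_zero] at hcard1
    exact absurd hne.card_pos (by omega)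
  obtain ⟨G₀, hG₀⟩ := hne₁
  have hs1 : 1 ≤ s := (mem_filter.1 hG₀).2.1
  have hWrich : Rich C (θ (s + 1)) (s + 1) W := (mem_filter.1 hG₀).2.2.1
  have hsr : s ≤ r := by
    have := (mem_product.1 hsW).1
    simp only [mem_range] at this
    omega
  set U : Finset V := {u ∈ W | Rich C (θ (s + 1)) s (nbrsIn C u W)} with hU
  have hUcard : θ (s + 1) ≤ (#U : ℝ) := hWrich
  have hUr : ∀ u ∈ U, Rich C (θ (s + 1)) s (nbrsIn C u W) := fun u hu => (mem_filter.1 hu).2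
  have hfam : ∀ u, ∃ 𝒟 : Finset (Finset V),
      #𝒟 ≤ (if u ∈ U then (Fintype.card V + 1) ^ (⌊θ s⌋₊ + s) else 1) ∧
      (u ∈ U → ∀ D ∈ 𝒟, D ⊆ nbrsIn C u W ∧ θ (s + 1) - θ s ≤ #D) ∧
      (∀ S ⊆ nbrsIn C u W, ¬ Rich C (θ s) s S → ∃ D ∈ 𝒟, u ∈ U → Disjoint D S) := by
    intro u
    by_cases hu : u ∈ U
    · obtain ⟨𝒟, h1, h2, h3⟩ := exists_family_disjoint_poor (θ' := θ s) C s _ (hUr u hu)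
      refine ⟨𝒟, by simpa [hu] using h1, fun _ => h2, fun S hS hp => ?_⟩
      obtain ⟨D, hD, hd⟩ := h3 S hS hp
      exact ⟨D, hD, fun _ => hd⟩
    -- Outside U a one-element dummy list is used, so these vertices contribute a factor 1 to the
    -- number of choices.
    · exact ⟨{∅}, by simp [hu], fun h => (hu h).elim, fun S _ _ => ⟨∅, by simp, fun h => (hu h).elim⟩⟩
  choose 𝒟 h1 h2 h3 using hfam
  obtain ⟨D, hDmem, hcard2⟩ := exists_card_le_mul_card_filter 𝒢₁ (Fintype.piFinset 𝒟)
    (fun G D => ∀ u ∈ U, Disjoint (D u) (nbrsIn G u W)) ⟨G₀, hG₀⟩ (by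
      intro G hG
      have hG' := mem_filter.1 hG
      have hex : ∀ u, ∃ D ∈ 𝒟 u, u ∈ U → Disjoint D (nbrsIn G u W) := by
        intro u
        by_cases hu : u ∈ U
        · exact h3 u _ (nbrsIn_mono (hle G hG'.1) u (Subset.refl _))
            (hG'.2.2.2 u (mem_filter.1 hu).1)
        · obtain ⟨D, hD, -⟩ := h3 u ∅ (empty_subset _) (by
            obtain ⟨s, rfl⟩ : ∃ k, s = k + 1 := ⟨s - 1, by omega⟩
            rw [rich_succ]
            simpa using hθ _)
          exact ⟨D, hD, fun h => (hu h).elim⟩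
      choose D hD1 hD2 using hex
      exact ⟨D, Fintype.mem_piFinset.2 hD1, hD2⟩)
  rw [Fintype.mem_piFinset] at hDmem
  have hDsub : ∀ u ∈ U, D u ⊆ nbrsIn C u W := fun u hu => (h2 u hu _ (hDmem u)).1
  have hDcard : ∀ u ∈ U, θ (s + 1) - θ s ≤ #(D u) := fun u hu => (h2 u hu _ (hDmem u)).2
  have hprod : #(Fintype.piFinset 𝒟) ≤ ((Fintype.card V + 1) ^ (⌊θ s⌋₊ + s)) ^ #U := by
    rw [Fintype.card_piFinset]
    refine (prod_le_prod' fun u _ => h1 u).trans (le_of_eq ?_)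
    rw [prod_ite, prod_const, prod_const_one, mul_one, filter_mem_eq_inter, univ_inter]
  have hpairs := adjPairs_deleteStars_add_le C U D
    (fun u hu x hx => (mem_nbrsIn.1 (hDsub u hu hx)).2)
  have hsum : (#U : ℝ) * (θ (s + 1) - θ s) ≤ ((∑ u ∈ U, #(D u) : ℕ) : ℝ) := by
    push_cast
    rw [← nsmul_eq_mul]
    exact card_nsmul_le_sum _ _ _ hDcard
  have hUpos : (0 : ℝ) < #U := (hθ _).trans_le hUcard
  have hgap : 0 < θ (s + 1) - θ s := sub_pos.2 (hθlt s)
  have hpairs' : (adjPairs (deleteStars C U D) : ℝ) + ((∑ u ∈ U, #(D u) : ℕ) : ℝ) ≤ adjPairs C := by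
    exact_mod_cast hpairs
  refine ⟨deleteStars C U D, lt_of_le_of_ne (deleteStars_le _ _ _) ?_, ?_⟩
  · intro h
    rw [h] at hpairs'
    nlinarith [mul_pos hUpos hgap]
  · have hsub : #{G ∈ 𝒢₁ | ∀ u ∈ U, Disjoint (D u) (nbrsIn G u W)} ≤
        #{G ∈ 𝒢 | G ≤ deleteStars C U D} := by
      refine card_le_card fun G hG => ?_
      rw [mem_filter, mem_filter] at hG
      have hkey : ∀ x y, G.Adj x y → ¬ (x ∈ U ∧ y ∈ D x) := by
        rintro x y hxy ⟨hx, hy⟩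
        exact disjoint_left.1 (hG.2 x hx) hy
          (mem_nbrsIn.2 ⟨(mem_nbrsIn.1 (hDsub x hx hy)).1, hxy⟩)
      exact mem_filter.2 ⟨hG.1.1, fun x y hxy =>
        ⟨hle G hG.1.1 hxy, hkey x y hxy, hkey y x hxy.symm⟩⟩
    have hfirst : #(range (r + 1) ×ˢ (univ : Finset (Finset V))) =
        (r + 1) * 2 ^ Fintype.card V := by
      rw [card_product, card_range, card_univ, Fintype.card_finset]
    rw [hfirst] at hcard1
    have hall : #𝒢 ≤ ((r + 1) * 2 ^ Fintype.card V) *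
        (((Fintype.card V + 1) ^ (⌊θ s⌋₊ + s)) ^ #U) * #{G ∈ 𝒢 | G ≤ deleteStars C U D} :=
      calc #𝒢 ≤ _ := hcard1
        _ ≤ (r + 1) * 2 ^ Fintype.card V * (((Fintype.card V + 1) ^ (⌊θ s⌋₊ + s)) ^ #U *
            #{G ∈ 𝒢 | G ≤ deleteStars C U D}) := by
          gcongr
          exact hcard2.trans (Nat.mul_le_mul hprod hsub)
        _ = _ := by ring
    have hall' : (#𝒢 : ℝ) ≤ ((r + 1) * 2 ^ Fintype.card V) *
        (((Fintype.card V + 1) ^ (⌊θ s⌋₊ + s)) ^ #U) * #{G ∈ 𝒢 | G ≤ deleteStars C U D} := by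
      exact_mod_cast hall
    refine hall'.trans (mul_le_mul_of_nonneg_right ?_ (Nat.cast_nonneg _))
    refine (hcost s #U hs1 hsr hUcard (card_le_univ _)).trans ?_
    refine Real.rpow_le_rpow_of_exponent_le (by norm_num) ?_
    exact mul_le_mul_of_nonneg_left (by linarith) ha

lemma not_rich_bot {θ : ℝ} (hθ : 0 < θ) {r : ℕ} (hr : 1 ≤ r) (S : Finset V) :
    ¬ Rich (⊥ : SimpleGraph V) θ (r + 1) S := by
  obtain ⟨r, rfl⟩ : ∃ k, r = k + 1 := ⟨r - 1, by omega⟩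
  have h0 : ∀ u, ¬ Rich (⊥ : SimpleGraph V) θ (r + 1) (nbrsIn ⊥ u S) := by
    intro u
    have : nbrsIn (⊥ : SimpleGraph V) u S = ∅ := by ext x; simp [mem_nbrsIn]
    rw [this, rich_succ]
    simpa using hθ
  rw [rich_succ]
  simpa [h0] using hθ

/-- Every family of clique-free subgraphs of `C` has a large subfamily inside a poor subgraph of
`C`. -/
theorem exists_poor_container [Fintype V] {r : ℕ} (hr : 1 ≤ r) {θ : ℕ → ℝ} (hθ : ∀ t, 0 < θ t)
    (hθlt : ∀ t, θ t < θ (t + 1)) {a : ℝ} (ha : 0 ≤ a)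
    (hcost : ∀ s u : ℕ, 1 ≤ s → s ≤ r → θ (s + 1) ≤ u → u ≤ Fintype.card V →
      ((r + 1) * 2 ^ Fintype.card V) * (((Fintype.card V + 1) ^ (⌊θ s⌋₊ + s)) ^ u : ℝ) ≤
        (2 : ℝ) ^ (a * (u * (θ (s + 1) - θ s))))
    (𝒢 : Finset (SimpleGraph V)) (hfree : ∀ G ∈ 𝒢, G.CliqueFree (r + 1)) (C : SimpleGraph V) :
    ∃ C' ≤ C, ¬ Rich C' (θ (r + 1)) (r + 1) univ ∧
      (#{G ∈ 𝒢 | G ≤ C} : ℝ) ≤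
        2 ^ (a * ((adjPairs C : ℝ) - adjPairs C')) * #{G ∈ 𝒢 | G ≤ C'} := by
  induction C using WellFoundedLT.induction with
  | ind C ih =>
    by_cases hrich : Rich C (θ (r + 1)) (r + 1) univ
    · rcases ({G ∈ 𝒢 | G ≤ C} : Finset (SimpleGraph V)).eq_empty_or_nonempty with he | hne
      · refine ⟨⊥, bot_le, not_rich_bot (hθ _) hr _, ?_⟩
        rw [he, card_empty, Nat.cast_zero]
        positivity
      · obtain ⟨C₁, hlt, h1⟩ := exists_lt_container hθ hθlt ha hcost C {G ∈ 𝒢 | G ≤ C}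
          (fun G hG => hfree G (mem_filter.1 hG).1) (fun G hG => (mem_filter.1 hG).2) hne hrich
        obtain ⟨C₂, hle, hpoor, h2⟩ := ih C₁ hlt
        refine ⟨C₂, hle.trans hlt.le, hpoor, h1.trans ?_⟩
        have h3 : (#{G ∈ ({G ∈ 𝒢 | G ≤ C} : Finset (SimpleGraph V)) | G ≤ C₁} : ℝ) ≤
            #{G ∈ 𝒢 | G ≤ C₁} := by
          exact_mod_cast card_le_card (filter_subset_filter _ (filter_subset _ _))
        calc _ ≤ (2 : ℝ) ^ (a * ((adjPairs C : ℝ) - adjPairs C₁)) *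
              (2 ^ (a * ((adjPairs C₁ : ℝ) - adjPairs C₂)) * #{G ∈ 𝒢 | G ≤ C₂}) :=
              mul_le_mul_of_nonneg_left (h3.trans h2) (by positivity)
          _ = _ := by
            rw [← mul_assoc, ← Real.rpow_add (by norm_num)]
            congr 2
            ring
    · exact ⟨C, le_rfl, hrich, by simp⟩

end Container

/-! ### Choice of thresholds for the container argument -/

section ContainerNumerics

variable {V : Type*} [Fintype V]

/-- Quantitative form of `exists_poor_container` with parameters given by powers of `L`. -/
theorem exists_poor_container_pow {r L : ℕ} (hr : 1 ≤ r) (hrL : r ≤ L) (hL : 10 ≤ L)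
    (hm : Fintype.card V + 1 ≤ 2 ^ L) (hLm : L ^ (24 + 28 * r) ≤ Fintype.card V)
    (𝒢 : Finset (SimpleGraph V)) (hfree : ∀ G ∈ 𝒢, G.CliqueFree (r + 1)) :
    ∃ C : SimpleGraph V, ¬ Rich C ((Fintype.card V : ℝ) / L ^ 12) (r + 1) univ ∧
      (#𝒢 : ℝ) ≤ 2 ^ ((Fintype.card V : ℝ) ^ 2 / L ^ 11) * #{G ∈ 𝒢 | G ≤ C} := by
  set m : ℕ := Fintype.card V with hmdef
  have hL0 : (10 : ℝ) ≤ L := by exact_mod_cast hL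
  have hLpos : (0 : ℝ) < L := by linarith
  have hLm' : (L : ℝ) ^ (24 + 28 * r) ≤ m := by exact_mod_cast hLm
  have hmpos : (0 : ℝ) < m := lt_of_lt_of_le (by positivity) hLm'
  -- The exponent makes θ (r + 1) = m / L^12 and θ 1 = m / L^(12 + 14r), which is at least √m.
  -- Consecutive thresholds differ by a factor L^14; after division by L^11 a factor near L^3
  -- remains, more than the L + L² needed for choosing the missed sets.
  set q : ℝ := (m : ℝ) / L ^ (26 + 14 * r) with hq
  have hqpos : 0 < q := by positivity
  let θ : ℕ → ℝ := fun t => q * (L : ℝ) ^ (14 * t)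
  have hθ : ∀ t, 0 < θ t := fun t => by positivity
  have hθsucc : ∀ t, θ (t + 1) = (L : ℝ) ^ 14 * θ t := fun t => by
    simp only [θ]; ring
  have hL14 : (10 : ℝ) ≤ (L : ℝ) ^ 14 := hL0.trans (le_self_pow₀ (by linarith) (by norm_num))
  have hθlt : ∀ t, θ t < θ (t + 1) := fun t => by
    rw [hθsucc]; nlinarith [hθ t]
  have hθtop : θ (r + 1) = (m : ℝ) / L ^ 12 := by
    simp only [θ, hq]
    rw [div_mul_eq_mul_div, div_eq_div_iff (by positivity) (by positivity)]
    ring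
  obtain ⟨C, -, hC1, hC2⟩ := exists_poor_container hr hθ hθlt (a := 1 / (L : ℝ) ^ 11)
    (by positivity) (by
      intro s u hs hsr hu hum
      set x : ℝ := θ s with hx
      have hxpos : 0 < x := hθ s
      have hx1 : (m : ℝ) / L ^ (12 + 14 * r) ≤ x := by
        have h1 : θ 1 = (m : ℝ) / L ^ (12 + 14 * r) := by
          simp only [θ, hq]
          rw [div_mul_eq_mul_div, div_eq_div_iff (by positivity) (by positivity)]
          ring
        rw [← h1]
        have hpow : (L : ℝ) ^ (14 * 1) ≤ (L : ℝ) ^ (14 * s) :=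
          pow_le_pow_right₀ (by linarith) (by omega)
        exact mul_le_mul_of_nonneg_left hpow hqpos.le
      have hx2 : (m : ℝ) ≤ x ^ 2 := by
        refine le_trans ?_ (pow_le_pow_left₀ (by positivity) hx1 2)
        rw [div_pow, le_div_iff₀ (by positivity), ← pow_mul]
        calc (m : ℝ) * L ^ ((12 + 14 * r) * 2) = m * L ^ (24 + 28 * r) := by ring_nf
          _ ≤ m * m := by gcongr
          _ = m ^ 2 := by ring
      have hm1 : (1 : ℝ) ≤ m := le_trans (one_le_pow₀ (by linarith)) hLm'
      have hx3 : 1 ≤ x := by nlinarith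
      rw [hθsucc] at hu ⊢
      have hsL : (s : ℝ) ≤ L := by exact_mod_cast hsr.trans hrL
      have hLm1 : (L : ℝ) ≤ m := le_trans (le_self_pow₀ (by linarith) (by omega)) hLm'
      have hr2 : (r : ℝ) + 1 ≤ 2 ^ L := by
        have : r + 1 ≤ 2 ^ L := by
          have := L.lt_two_pow_self
          omega
        exact_mod_cast this
      have hm2 : (m : ℝ) + 1 ≤ 2 ^ L := by exact_mod_cast hm
      have hupos : (0 : ℝ) ≤ u := Nat.cast_nonneg _
      have hfl : (⌊x⌋₊ : ℝ) ≤ x := Nat.floor_le hxpos.le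
      have step1 : ((r : ℝ) + 1) * 2 ^ m * (((m : ℝ) + 1) ^ (⌊x⌋₊ + s)) ^ u ≤
          2 ^ (L + m + L * (⌊x⌋₊ + s) * u) := by
        rw [pow_add (2 : ℝ) (L + m), pow_add (2 : ℝ) L, pow_mul (2 : ℝ) (L * _), pow_mul (2 : ℝ) L]
        gcongr
      refine step1.trans ?_
      rw [← Real.rpow_natCast]
      refine Real.rpow_le_rpow_of_exponent_le (by norm_num) ?_
      push_cast
      have e1 : 1 / (L : ℝ) ^ 11 * (u * ((L : ℝ) ^ 14 * x - x)) =
          u * x * ((L : ℝ) ^ 3 - 1 / (L : ℝ) ^ 11) := by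
        field_simp
      rw [e1]
      have h11 : 1 / (L : ℝ) ^ 11 ≤ 1 := by
        rw [div_le_one (by positivity)]
        exact one_le_pow₀ (by linarith)
      -- From u ≥ L^14 x and x² ≥ m; this absorbs the factor 2^m for the choice of W.
      have hux : (m : ℝ) ≤ u * x := by nlinarith
      have hux0 : 0 ≤ u * x := by positivity
      have hA : (L : ℝ) * (⌊x⌋₊ + s) * u ≤ L * (x + L) * u := by gcongr
      have hB : (L : ℝ) * (x + L) * u ≤ (L + L ^ 2) * (u * x) := by
        nlinarith [mul_nonneg (mul_nonneg (sq_nonneg (L : ℝ)) hupos) (sub_nonneg.2 hx3)]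
      have hD : (L + (L : ℝ) ^ 2) + 2 ≤ L ^ 3 - 1 := by nlinarith [mul_pos hLpos hLpos]
      calc (L : ℝ) + m + L * (⌊x⌋₊ + s) * u ≤ 2 * (u * x) + (L + L ^ 2) * (u * x) := by linarith
        _ = u * x * (L + (L : ℝ) ^ 2 + 2) := by ring
        _ ≤ u * x * (L ^ 3 - 1 / (L : ℝ) ^ 11) := by gcongr; linarith)
    𝒢 hfree ⊤
  rw [hθtop] at hC1
  refine ⟨C, hC1, ?_⟩
  have htop : ({G ∈ 𝒢 | G ≤ (⊤ : SimpleGraph V)} : Finset (SimpleGraph V)) = 𝒢 := by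
    rw [filter_eq_self]; exact fun G _ => le_top
  rw [htop] at hC2
  refine hC2.trans (mul_le_mul_of_nonneg_right ?_ (Nat.cast_nonneg _))
  refine Real.rpow_le_rpow_of_exponent_le (by norm_num) ?_
  have h1 : (adjPairs (⊤ : SimpleGraph V) : ℝ) ≤ (m : ℝ) ^ 2 := by exact_mod_cast adjPairs_le_sq _
  have h2 : (0 : ℝ) ≤ adjPairs C := Nat.cast_nonneg _
  rw [one_div_mul_eq_div]
  gcongr
  linarith

end ContainerNumerics

/-! ### Füredi-type stability for poor graphs -/

section Stability

variable {V : Type*}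

/-- The defect of a pair of vertices with respect to the colouring `c`: summed over all ordered
pairs, it compares the edges of `F`, the monochromatic ones counted twice, with the complete
multipartite graph given by `c`. -/
noncomputable def pairDefect (F : SimpleGraph V) (c : V → ℕ) (x y : V) : ℝ :=
  if c x = c y then (if F.Adj x y then 2 else 0) else (if F.Adj x y then 0 else -1)

lemma pairDefect_comm (F : SimpleGraph V) (c : V → ℕ) (x y : V) :
    pairDefect F c x y = pairDefect F c y x := by
  simp only [pairDefect, F.adj_comm x y, eq_comm (a := c x)]

lemma pairDefect_le (F : SimpleGraph V) (c : V → ℕ) (x y : V) :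
    pairDefect F c x y ≤ 2 * (if F.Adj x y then 1 else 0) := by
  unfold pairDefect
  split_ifs <;> norm_num

lemma sum_sum_union_of_comm (f : V → V → ℝ) (hf : ∀ x y, f x y = f y x) {A B : Finset V}
    (h : Disjoint A B) :
    ∑ x ∈ A ∪ B, ∑ y ∈ A ∪ B, f x y =
      ∑ x ∈ B, ∑ y ∈ B, f x y + 2 * ∑ x ∈ A, ∑ y ∈ B, f x y + ∑ x ∈ A, ∑ y ∈ A, f x y := by
  simp only [sum_union h, sum_add_distrib]
  have : ∑ x ∈ B, ∑ y ∈ A, f x y = ∑ x ∈ A, ∑ y ∈ B, f x y := by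
    rw [sum_comm]
    simp only [hf]
  rw [this]
  ring

lemma card_nbrsIn_eq_sum (F : SimpleGraph V) (x : V) (S : Finset V) :
    (#(nbrsIn F x S) : ℝ) = ∑ y ∈ S, if F.Adj x y then (1 : ℝ) else 0 := by
  rw [nbrsIn, sum_boole]

/-- Stability for graphs with few robust cliques, after Füredi. -/
theorem exists_coloring_of_not_rich [Fintype V] (F : SimpleGraph V) {θ : ℝ} (hθ : 0 ≤ θ)
    (t : ℕ) (S : Finset V) (hS : ¬ Rich F θ (t + 2) S) :
    ∃ c : V → ℕ, (∀ x, c x ≤ t) ∧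
      ∑ x ∈ S, ∑ y ∈ S, pairDefect F c x y ≤ 2 * (t + 2) * θ * Fintype.card V := by
  set M : ℝ := (Fintype.card V : ℝ) with hM
  have hM0 : 0 ≤ M := Nat.cast_nonneg _
  have hcardM : ∀ T : Finset V, (#T : ℝ) ≤ M := fun T => by
    rw [hM]; exact_mod_cast card_le_univ T
  induction t generalizing S with
  | zero =>
    refine ⟨fun _ => 0, fun _ => le_rfl, ?_⟩
    rw [rich_succ, not_le] at hS
    have hx : ∀ x ∈ S, ∑ y ∈ S, pairDefect F (fun _ => 0) x y ≤
        2 * ((if Rich F θ 1 (nbrsIn F x S) then M else 0) + θ) := by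
      intro x _
      have h1 : ∑ y ∈ S, pairDefect F (fun _ => 0) x y ≤ 2 * #(nbrsIn F x S) := by
        rw [card_nbrsIn_eq_sum, mul_sum]
        exact sum_le_sum fun y _ => pairDefect_le _ _ _ _
      refine h1.trans (mul_le_mul_of_nonneg_left ?_ (by norm_num))
      split_ifs with h
      · linarith [hcardM (nbrsIn F x S)]
      · have h' : (#(nbrsIn F x S) : ℝ) < θ := by
          have he : ({u ∈ nbrsIn F x S | Rich F θ 0 (nbrsIn F u (nbrsIn F x S))} : Finset V) =
              nbrsIn F x S := filter_true_of_mem fun _ _ => trivial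
          rwa [rich_succ, not_le, he] at h
        linarith
    refine (sum_le_sum hx).trans ?_
    rw [← mul_sum, sum_add_distrib, ← sum_filter, sum_const, sum_const, nsmul_eq_mul, nsmul_eq_mul]
    have h2 := mul_le_mul_of_nonneg_right hS.le hM0
    have h3 := mul_le_mul_of_nonneg_right (hcardM S) hθ
    push_cast
    linarith
  | succ t ih =>
    rw [rich_succ, not_le] at hS
    set good : Finset V := {u ∈ S | ¬ Rich F θ (t + 2) (nbrsIn F u S)} with hgood
    -- If no vertex has a poor neighbourhood, then S itself has fewer than θ vertices and any
    -- colouring works.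
    rcases good.eq_empty_or_nonempty with he | hne
    · refine ⟨fun _ => 0, fun _ => Nat.zero_le _, ?_⟩
      have hall : ({u ∈ S | Rich F θ (t + 2) (nbrsIn F u S)} : Finset V) = S := by
        rw [filter_eq_self]
        intro u hu
        by_contra h
        exact (eq_empty_iff_forall_notMem.1 he) u (mem_filter.2 ⟨hu, h⟩)
      rw [show t + 1 + 1 = t + 2 from rfl, hall] at hS
      have hx : ∀ x ∈ S, ∑ y ∈ S, pairDefect F (fun _ => 0) x y ≤ 2 * M := by
        intro x _
        have h1 : ∑ y ∈ S, pairDefect F (fun _ => 0) x y ≤ 2 * #(nbrsIn F x S) := by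
          rw [card_nbrsIn_eq_sum, mul_sum]
          exact sum_le_sum fun y _ => pairDefect_le _ _ _ _
        linarith [hcardM (nbrsIn F x S)]
      refine (sum_le_sum hx).trans ?_
      rw [sum_const, nsmul_eq_mul]
      have h2 := mul_le_mul_of_nonneg_right hS.le hM0
      have h3 : 0 ≤ θ * M := mul_nonneg hθ hM0
      have h4 : 0 ≤ (t : ℝ) * (θ * M) := mul_nonneg (Nat.cast_nonneg _) h3
      push_cast
      nlinarith
    -- Füredi's choice: take v of maximum degree, here only among vertices with poor neighbourhood.
    -- Its non-neighbours in S form a new colour class, and its neighbourhood is coloured by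
    -- induction.
    · obtain ⟨v, hv, hmax⟩ := exists_max_image good (fun u => #(nbrsIn F u S)) hne
      set B := nbrsIn F v S with hB
      set A := S \ B with hA
      have hBS : B ⊆ S := nbrsIn_subset _ _ _
      have hSAB : S = A ∪ B := (sdiff_union_of_subset hBS).symm
      have hdisj : Disjoint A B := sdiff_disjoint
      obtain ⟨c, hc, hcsum⟩ := ih B (mem_filter.1 hv).2
      refine ⟨fun x => if x ∈ A then t + 1 else c x, fun x => ?_, ?_⟩
      · dsimp only
        split_ifs
        · exact le_rfl
        · exact (hc x).trans (Nat.le_succ t)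
      set c' : V → ℕ := fun x => if x ∈ A then t + 1 else c x with hc'
      have hcA : ∀ x ∈ A, c' x = t + 1 := fun x hx => if_pos hx
      have hcB : ∀ x ∈ B, c' x = c x := fun x hx => if_neg (disjoint_right.1 hdisj hx)
      have hBB : ∑ x ∈ B, ∑ y ∈ B, pairDefect F c' x y = ∑ x ∈ B, ∑ y ∈ B, pairDefect F c x y := by
        refine sum_congr rfl fun x hx => sum_congr rfl fun y hy => ?_
        simp only [pairDefect, hcB x hx, hcB y hy]
      have hAA : ∑ x ∈ A, ∑ y ∈ A, pairDefect F c' x y = ∑ x ∈ A, 2 * (#(nbrsIn F x A) : ℝ) := by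
        refine sum_congr rfl fun x hx => ?_
        rw [card_nbrsIn_eq_sum, mul_sum]
        refine sum_congr rfl fun y hy => ?_
        simp only [pairDefect, hcA x hx, hcA y hy, if_true]
        split_ifs <;> norm_num
      have hAB : ∑ x ∈ A, ∑ y ∈ B, pairDefect F c' x y =
          ∑ x ∈ A, ((#(nbrsIn F x B) : ℝ) - #B) := by
        refine sum_congr rfl fun x hx => ?_
        rw [card_nbrsIn_eq_sum, card_eq_sum_ones, Nat.cast_sum, ← sum_sub_distrib]
        refine sum_congr rfl fun y hy => ?_
        have hne : ¬ (t + 1 = c y) := by have := hc y; omega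
        simp only [pairDefect, hcA x hx, hcB y hy, hne, if_false]
        split_ifs <;> norm_num
      have hdeg : ∀ x, (#(nbrsIn F x S) : ℝ) = #(nbrsIn F x A) + #(nbrsIn F x B) := by
        intro x
        simp only [card_nbrsIn_eq_sum]
        rw [hSAB, sum_union hdisj]
      -- Good vertices have degree at most |B|, and the fewer than θ remaining ones cost at most M
      -- each. The degree sum over A counts edges inside A twice and edges to B once, so its excess
      -- over |A||B| is half the new defect.
      have hle : ∑ x ∈ A, (#(nbrsIn F x S) : ℝ) ≤ ∑ x ∈ A, (#B : ℝ) + θ * M := by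
        have h1 : ∀ x ∈ A, (#(nbrsIn F x S) : ℝ) ≤
            #B + if Rich F θ (t + 2) (nbrsIn F x S) then M else 0 := by
          intro x hx
          have hxS : x ∈ S := (mem_sdiff.1 hx).1
          split_ifs with h
          · have := hcardM (nbrsIn F x S)
            have h0 : (0 : ℝ) ≤ #B := Nat.cast_nonneg _
            linarith
          · have := hmax x (mem_filter.2 ⟨hxS, h⟩)
            rw [add_zero]
            exact_mod_cast this
        refine (sum_le_sum h1).trans ?_
        rw [sum_add_distrib, ← sum_filter, sum_const M, nsmul_eq_mul]
        have h2 : (#{x ∈ A | Rich F θ (t + 2) (nbrsIn F x S)} : ℝ) ≤ θ := by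
          refine le_trans ?_ hS.le
          exact_mod_cast card_le_card (filter_subset_filter _ sdiff_subset)
        have := mul_le_mul_of_nonneg_right h2 hM0
        linarith
      have htot : ∑ x ∈ S, ∑ y ∈ S, pairDefect F c' x y = ∑ x ∈ B, ∑ y ∈ B, pairDefect F c x y +
          2 * (∑ x ∈ A, (#(nbrsIn F x S) : ℝ) - ∑ x ∈ A, (#B : ℝ)) := by
        conv_lhs => rw [hSAB]
        rw [sum_sum_union_of_comm _ (pairDefect_comm F c') hdisj, hBB, hAA, hAB]
        simp only [hdeg, sum_add_distrib, sum_sub_distrib, ← mul_sum]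
        ring
      rw [htot]
      push_cast
      nlinarith [hcsum, hle]

end Stability

/-! ### Counting subgraphs and K_{r+1}-free graphs -/

section Counting

variable {V : Type*}

/-- The complete multipartite graph whose parts are the colour classes of `c`. -/
def crossGraph {α : Type*} (c : V → α) : SimpleGraph V where
  Adj x y := c x ≠ c y
  symm := ⟨fun _ _ h => h.symm⟩
  loopless := ⟨fun _ h => h rfl⟩

lemma crossGraph_adj {α : Type*} {c : V → α} {x y : V} : (crossGraph c).Adj x y ↔ c x ≠ c y :=
  Iff.rfl

variable [Fintype V]

/-- The colour class of `i`. -/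
noncomputable def colorClass {α : Type*} (c : V → α) (i : α) : Finset V := {x | c x = i}

lemma mem_colorClass {α : Type*} {c : V → α} {i : α} {x : V} : x ∈ colorClass c i ↔ c x = i := by
  simp [colorClass]

lemma colorClass_eq_filter {α : Type*} [DecidableEq α] (c : V → α) (i : α) :
    colorClass c i = ({x | c x = i} : Finset V) := by
  ext x
  simp [mem_colorClass]

/-- The number of ordered pairs of adjacent vertices of the same colour. -/
noncomputable def monoPairs {α : Type*} (G : SimpleGraph V) (c : V → α) : ℕ :=
  #{p : V × V | G.Adj p.1 p.2 ∧ c p.1 = c p.2}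

lemma monoPairs_mono {α : Type*} {G H : SimpleGraph V} (h : G ≤ H) (c : V → α) :
    monoPairs G c ≤ monoPairs H c :=
  card_le_card fun p hp => by
    simp only [mem_filter, mem_univ, true_and] at hp ⊢
    exact ⟨h hp.1, hp.2⟩

lemma card_le_card_filter_le (C : SimpleGraph V) :
    (#{G : SimpleGraph V | G ≤ C} : ℝ) ≤ 2 ^ ((adjPairs C : ℝ) / 2) := by
  have h1 : #{G : SimpleGraph V | G ≤ C} ≤ 2 ^ #C.edgeFinset := by
    rw [← card_powerset]
    refine card_le_card_of_injOn (fun G => G.edgeFinset) ?_ ?_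
    · intro G hG
      simp only [coe_filter, mem_univ, true_and, Set.mem_ofPred_eq] at hG
      simpa using hG
    · intro G _ H _ h
      exact SimpleGraph.edgeFinset_inj.1 h
  have h2 : 2 * #C.edgeFinset = adjPairs C := by
    rw [SimpleGraph.two_mul_card_edgeFinset, adjPairs]
  have h3 : (adjPairs C : ℝ) / 2 = (#C.edgeFinset : ℕ) := by
    rw [← h2]; push_cast; ring
  rw [h3, Real.rpow_natCast]
  exact_mod_cast h1

/-- Splitting a family of subgraphs of `E` along a subgraph `D`. -/
lemma card_le_of_inf_mem (E D : SimpleGraph V) (𝒢 𝒬 : Finset (SimpleGraph V))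
    (h𝒢 : ∀ G ∈ 𝒢, G ≤ E) (h𝒬 : ∀ G ∈ 𝒢, G ⊓ D ∈ 𝒬) :
    (#𝒢 : ℝ) ≤ 2 ^ ((adjPairs (E \ D) : ℝ) / 2) * #𝒬 := by
  have h1 : #𝒢 ≤ #({G : SimpleGraph V | G ≤ E \ D} : Finset _) * #𝒬 := by
    rw [← card_product]
    refine card_le_card_of_injOn (fun G => (G \ D, G ⊓ D)) ?_ ?_
    · intro G hG
      rw [mem_coe] at hG
      simp only [coe_product, Set.mem_prod, mem_coe, mem_filter, mem_univ, true_and]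
      exact ⟨sdiff_le_sdiff_right (h𝒢 G hG), h𝒬 G hG⟩
    · intro G _ H _ h
      simp only [Prod.mk.injEq] at h
      rw [← sup_inf_sdiff G D, ← sup_inf_sdiff H D, h.1, h.2]
  calc (#𝒢 : ℝ) ≤ (#({G : SimpleGraph V | G ≤ E \ D} : Finset _) : ℝ) * #𝒬 := by exact_mod_cast h1
    _ ≤ _ := mul_le_mul_of_nonneg_right (card_le_card_filter_le _) (Nat.cast_nonneg _)

lemma adjPairs_sdiff_add {E D : SimpleGraph V} (h : D ≤ E) :
    adjPairs (E \ D) + adjPairs D = adjPairs E := by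
  rw [adjPairs, adjPairs, adjPairs, ← card_union_of_disjoint]
  · congr 1
    ext p
    simp only [SimpleGraph.sdiff_adj, mem_union, mem_filter, mem_univ, true_and]
    constructor
    · rintro (h' | h')
      exacts [h'.1, h h']
    · intro h'
      by_cases h'' : D.Adj p.1 p.2 <;> tauto
  · rw [disjoint_left]
    intro p hp hp'
    simp only [SimpleGraph.sdiff_adj, mem_filter, mem_univ, true_and] at hp hp'
    exact hp.2 hp'

lemma adjPairs_sup_crossGraph {α : Type*} (C : SimpleGraph V) (c : V → α) :
    adjPairs (C ⊔ crossGraph c) = monoPairs C c + adjPairs (crossGraph c) := by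
  rw [adjPairs, adjPairs, monoPairs, ← card_union_of_disjoint]
  · congr 1
    ext p
    simp only [SimpleGraph.sup_adj, mem_union, mem_filter, mem_univ, true_and, crossGraph_adj]
    tauto
  · rw [disjoint_left]
    intro p hp hp'
    simp only [mem_filter, mem_univ, true_and, crossGraph_adj] at hp hp'
    exact hp' hp.2

lemma adjPairs_eq_sum (G : SimpleGraph V) :
    (adjPairs G : ℝ) = ∑ x, ∑ y, if G.Adj x y then (1 : ℝ) else 0 := by
  rw [adjPairs, ← sum_boole, ← univ_product_univ, sum_product]

lemma monoPairs_eq_sum {α : Type*} (G : SimpleGraph V) (c : V → α) :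
    (monoPairs G c : ℝ) = ∑ x, ∑ y, if G.Adj x y ∧ c x = c y then (1 : ℝ) else 0 := by
  rw [monoPairs, ← sum_boole, ← univ_product_univ, sum_product]

/-- A poor graph is close to a complete `r`-partite graph, or has few edges. -/
lemma exists_fin_coloring_of_not_rich {r : ℕ} (hr : 1 ≤ r) (C : SimpleGraph V) {θ : ℝ} (hθ : 0 ≤ θ)
    (hC : ¬ Rich C θ (r + 1) univ) :
    ∃ c : V → Fin r, (adjPairs C : ℝ) + monoPairs C c ≤
      adjPairs (crossGraph c) + 2 * (r + 1) * θ * Fintype.card V := by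
  obtain ⟨t, rfl⟩ : ∃ t, r = t + 1 := ⟨r - 1, by omega⟩
  obtain ⟨c, hc, hsum⟩ := exists_coloring_of_not_rich C hθ t univ hC
  refine ⟨fun x => ⟨c x, by have := hc x; omega⟩, ?_⟩
  rw [adjPairs_eq_sum, adjPairs_eq_sum, monoPairs_eq_sum]
  -- The total defect is the number of adjacent pairs, plus the monochromatic adjacent pairs, minus
  -- all bichromatic pairs.
  have key : ∑ x, ∑ y, pairDefect C c x y = (∑ x, ∑ y, if C.Adj x y then (1 : ℝ) else 0) +
      (∑ x, ∑ y, if C.Adj x y ∧ c x = c y then (1 : ℝ) else 0) -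
      ∑ x, ∑ y, if c x ≠ c y then (1 : ℝ) else 0 := by
    simp only [← sum_add_distrib, ← sum_sub_distrib]
    refine sum_congr rfl fun x _ => sum_congr rfl fun y _ => ?_
    unfold pairDefect
    by_cases h1 : c x = c y <;> by_cases h2 : C.Adj x y <;> (simp [h1, h2]; try norm_num)
  rw [key] at hsum
  simp only [crossGraph_adj, ne_eq, Fin.mk.injEq]
  simp only [ne_eq] at hsum
  push_cast
  linarith

lemma sum_card_colorClass {r : ℕ} (c : V → Fin r) :
    ∑ i, (#(colorClass c i) : ℝ) = Fintype.card V := by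
  have h : ∑ i, #(colorClass c i) = Fintype.card V := by
    rw [← card_univ, card_eq_sum_card_fiberwise (f := c) (t := univ) fun _ _ => mem_univ _]
    exact sum_congr rfl fun i _ => by rw [colorClass_eq_filter]
  exact_mod_cast h

lemma adjPairs_crossGraph {r : ℕ} (c : V → Fin r) :
    (adjPairs (crossGraph c) : ℝ) =
      (Fintype.card V : ℝ) ^ 2 - ∑ i, (#(colorClass c i) : ℝ) ^ 2 := by
  have h1 : ∀ x : V, (∑ y, if (crossGraph c).Adj x y then (1 : ℝ) else 0) =
      Fintype.card V - #(colorClass c (c x)) := by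
    intro x
    have : (#(colorClass c (c x)) : ℝ) = ∑ y, if c x = c y then (1 : ℝ) else 0 := by
      rw [sum_boole]
      congr 2
      ext y
      simp [mem_colorClass, eq_comm]
    rw [this, Fintype.card, card_eq_sum_ones, Nat.cast_sum, ← sum_sub_distrib]
    refine sum_congr rfl fun y _ => ?_
    by_cases h : c x = c y <;> simp [crossGraph_adj, h]
  have h2 : ∑ x : V, (#(colorClass c (c x)) : ℝ) = ∑ i, (#(colorClass c i) : ℝ) ^ 2 := by
    rw [← sum_fiberwise univ c]
    refine sum_congr rfl fun i _ => ?_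
    have : ∀ x ∈ ({x | c x = i} : Finset V), (#(colorClass c (c x)) : ℝ) = #(colorClass c i) := by
      intro x hx
      rw [(mem_filter.1 hx).2]
    rw [sum_congr rfl this, sum_const, nsmul_eq_mul, sq, colorClass_eq_filter]
  rw [adjPairs_eq_sum, sum_congr rfl fun x _ => h1 x, sum_sub_distrib, h2, sum_const, card_univ,
    nsmul_eq_mul, sq]

/-- Variance identity for the class sizes, whose mean is |V| / r. Dropping the squares gives the
Turán bound; keeping one of them penalises an undersized class. -/
lemma adjPairs_crossGraph_eq {r : ℕ} (hr : 1 ≤ r) (c : V → Fin r) :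
    (adjPairs (crossGraph c) : ℝ) = (1 - 1 / r) * (Fintype.card V : ℝ) ^ 2 -
      ∑ i, ((#(colorClass c i) : ℝ) - Fintype.card V / r) ^ 2 := by
  have hr0 : (r : ℝ) ≠ 0 := by positivity
  rw [adjPairs_crossGraph]
  have : ∑ i, ((#(colorClass c i) : ℝ) - Fintype.card V / r) ^ 2 =
      ∑ i, (#(colorClass c i) : ℝ) ^ 2 - 2 * (Fintype.card V / r) * ∑ i, (#(colorClass c i) : ℝ) +
        r * (Fintype.card V / r : ℝ) ^ 2 := by
    simp only [sub_sq, sum_add_distrib, sum_sub_distrib, mul_sum, sum_const, card_univ,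
      Fintype.card_fin, nsmul_eq_mul]
    congr 2
    exact sum_congr rfl fun i _ => by ring
  rw [this, sum_card_colorClass]
  field_simp
  ring

lemma adjPairs_crossGraph_le {r : ℕ} (hr : 1 ≤ r) (c : V → Fin r) :
    (adjPairs (crossGraph c) : ℝ) ≤ (1 - 1 / r) * (Fintype.card V : ℝ) ^ 2 := by
  rw [adjPairs_crossGraph_eq hr]
  have : 0 ≤ ∑ i, ((#(colorClass c i) : ℝ) - Fintype.card V / r) ^ 2 :=
    sum_nonneg fun i _ => sq_nonneg _
  linarith

lemma adjPairs_crossGraph_le_of_lt {r : ℕ} (hr : 1 ≤ r) (c : V → Fin r) {s : ℝ} (hs : 0 ≤ s)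
    (i : Fin r) (hi : (#(colorClass c i) : ℝ) < Fintype.card V / r - s) :
    (adjPairs (crossGraph c) : ℝ) ≤ (1 - 1 / r) * (Fintype.card V : ℝ) ^ 2 - s ^ 2 := by
  rw [adjPairs_crossGraph_eq hr]
  have h1 : ((#(colorClass c i) : ℝ) - Fintype.card V / r) ^ 2 ≤
      ∑ i, ((#(colorClass c i) : ℝ) - Fintype.card V / r) ^ 2 :=
    single_le_sum (f := fun i => ((#(colorClass c i) : ℝ) - Fintype.card V / r) ^ 2)
      (fun i _ => sq_nonneg _) (mem_univ i)
  nlinarith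

/-- The number of graphs on `V` without `s`-cliques. -/
noncomputable def numCliqueFree (V : Type*) (s : ℕ) : ℕ :=
  Nat.card {G : SimpleGraph V // G.CliqueFree s}

lemma numCliqueFree_eq (s : ℕ) :
    numCliqueFree V s = #{G : SimpleGraph V | G.CliqueFree s} := by
  rw [numCliqueFree, Nat.card_eq_fintype_card, Fintype.card_subtype]

/-- An upper bound for the number of `K_{r+1}`-free graphs. -/
theorem card_cliqueFree_le {r L : ℕ} (hr : 1 ≤ r) (hrL : r ≤ L) (hL : 10 ≤ L)
    (hm : Fintype.card V + 1 ≤ 2 ^ L) (hLm : L ^ (24 + 28 * r) ≤ Fintype.card V) :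
    (numCliqueFree V (r + 1) : ℝ) ≤
      2 ^ ((1 - 1 / (r : ℝ)) * (Fintype.card V : ℝ) ^ 2 / 2 +
        3 * (Fintype.card V : ℝ) ^ 2 / L ^ 11) := by
  rw [numCliqueFree_eq]
  set m : ℝ := (Fintype.card V : ℝ) with hmdef
  have hL0 : (0 : ℝ) < L := by exact_mod_cast (by omega : 0 < L)
  obtain ⟨C, hC, hcard⟩ := exists_poor_container_pow hr hrL hL hm hLm
    {G : SimpleGraph V | G.CliqueFree (r + 1)} (fun G hG => (mem_filter.1 hG).2)
  obtain ⟨c, hc⟩ := exists_fin_coloring_of_not_rich hr C (by positivity) hC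
  have h1 := adjPairs_crossGraph_le hr c
  have h2 : (0 : ℝ) ≤ monoPairs C c := Nat.cast_nonneg _
  rw [← hmdef] at hcard hc h1
  have hsub : (#{G ∈ ({G : SimpleGraph V | G.CliqueFree (r + 1)} : Finset _) | G ≤ C} : ℝ) ≤
      2 ^ ((adjPairs C : ℝ) / 2) := by
    refine le_trans ?_ (card_le_card_filter_le C)
    exact_mod_cast card_le_card (filter_subset_filter _ (filter_subset _ _))
  refine (hcard.trans (mul_le_mul_of_nonneg_left hsub (by positivity))).trans ?_
  rw [← Real.rpow_add (by norm_num)]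
  refine Real.rpow_le_rpow_of_exponent_le (by norm_num) ?_
  have h3 : 2 * (r + 1) * (m / L ^ 12) * m ≤ 4 * (m ^ 2 / L ^ 11) := by
    have hr1 : (r : ℝ) + 1 ≤ 2 * L := by
      have : r + 1 ≤ 2 * L := by omega
      exact_mod_cast this
    have e : 2 * ((r : ℝ) + 1) * (m / L ^ 12) * m = 2 * ((r + 1) / L) * (m ^ 2 / L ^ 11) := by
      field_simp
    rw [e]
    have : ((r : ℝ) + 1) / L ≤ 2 := by rw [div_le_iff₀ hL0]; exact hr1
    have h0 : 0 ≤ m ^ 2 / (L : ℝ) ^ 11 := by positivity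
    nlinarith
  have e3 : 3 * m ^ 2 / (L : ℝ) ^ 11 = 3 * (m ^ 2 / L ^ 11) := by ring
  rw [e3]
  linarith

end Counting

/-! ### Nice partitions and the two ways in which they fail -/

section Nice

variable {V : Type*}

/-- The edges of `G` between `X` and `Y`, as ordered pairs. -/
noncomputable def edgesBetween (G : SimpleGraph V) (X Y : Finset V) : Finset (V × V) :=
  {p ∈ X ×ˢ Y | G.Adj p.1 p.2}

lemma mem_edgesBetween {G : SimpleGraph V} {X Y : Finset V} {p : V × V} :
    p ∈ edgesBetween G X Y ↔ p ∈ X ×ˢ Y ∧ G.Adj p.1 p.2 := by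
  simp [edgesBetween]

variable [Fintype V]

/-- The colouring `c` is a nice partition for `G`: no part is small, large subsets of the parts
contain transversal cliques, there are at most `d` ordered monochromatic edges, and more than `2 * d`
edges between any two large subsets of distinct parts. -/
structure IsNice (G : SimpleGraph V) {r : ℕ} (c : V → Fin r) (b : ℕ) (s d : ℝ) : Prop where
  le_card : ∀ i, (Fintype.card V : ℝ) / r - s ≤ #(colorClass c i)
  transversal : ∀ B : Fin r → Finset V, (∀ i, B i ⊆ colorClass c i) → (∀ i, b ≤ #(B i)) →
    ∃ f : Fin r → V, (∀ i, f i ∈ B i) ∧ ∀ i j, i ≠ j → G.Adj (f i) (f j)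
  mono_le : (monoPairs G c : ℝ) ≤ d
  lt_card : ∀ i j, i ≠ j → ∀ X ⊆ colorClass c i, ∀ Y ⊆ colorClass c j, b ≤ #X → b ≤ #Y →
    2 * d < #(edgesBetween G X Y)

/-- The complete multipartite graph on the colour classes of `c`, restricted to `Z`. -/
def crossGraphOn {α : Type*} (c : V → α) (Z : Finset V) : SimpleGraph V where
  Adj x y := c x ≠ c y ∧ x ∈ Z ∧ y ∈ Z
  symm := ⟨fun _ _ h => ⟨h.1.symm, h.2.2, h.2.1⟩⟩
  loopless := ⟨fun _ h => h.1 rfl⟩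

lemma adjPairs_crossGraphOn {r : ℕ} (c : V → Fin r) (Z : Finset V) (b : ℕ)
    (hZ : ∀ i, #{x ∈ Z | c x = i} = b) :
    (r : ℝ) * (r - 1) * b ^ 2 ≤ adjPairs (crossGraphOn c Z) := by
  let c' : Z → Fin r := fun x => c x
  have h1 : ∀ i, #(colorClass c' i) = b := by
    intro i
    rw [← hZ i, ← card_map (Function.Embedding.subtype (· ∈ Z))]
    congr 1
    ext x
    simp [mem_colorClass, c', and_comm]
  have h2 : (Fintype.card Z : ℝ) = r * b := by
    rw [← sum_card_colorClass c']
    simp [h1]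
  have h3 := adjPairs_crossGraph c'
  rw [h2] at h3
  simp only [h1, sum_const, card_univ, Fintype.card_fin, nsmul_eq_mul] at h3
  have h4 : adjPairs (crossGraph c') ≤ adjPairs (crossGraphOn c Z) := by
    refine card_le_card_of_injOn (fun p => ((p.1 : V), (p.2 : V))) ?_ ?_
    · rintro ⟨x, y⟩ h
      exact mem_coe.2 (mem_filter.2
        ⟨mem_univ _, (mem_filter.1 (mem_coe.1 h)).2, x.2, y.2⟩)
    · rintro ⟨x, y⟩ _ ⟨x', y'⟩ _ h
      simp only [Prod.mk.injEq] at h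
      exact Prod.ext (Subtype.ext h.1) (Subtype.ext h.2)
  have h5 : (adjPairs (crossGraph c') : ℝ) ≤ adjPairs (crossGraphOn c Z) := by exact_mod_cast h4
  refine le_trans (le_of_eq ?_) h5
  rw [h3]
  ring

/-- The graphs below `C` without transversal clique in `Z` are few. -/
lemma card_filter_no_transversal_le {r : ℕ} (hr : 2 ≤ r) (c : V → Fin r) (C : SimpleGraph V) (Z : Finset V)
    (b : ℕ) (hZ : ∀ i, #{x ∈ Z | c x = i} = b) :
    (#{G : SimpleGraph V | G ≤ C ∧ ¬ ∃ f : Fin r → V, (∀ i, f i ∈ Z ∧ c (f i) = i) ∧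
        ∀ i j, i ≠ j → G.Adj (f i) (f j)} : ℝ) ≤
      2 ^ (((monoPairs C c : ℝ) + adjPairs (crossGraph c) - r * (r - 1) * b ^ 2) / 2) *
        numCliqueFree Z r := by
  have hle : crossGraphOn c Z ≤ C ⊔ crossGraph c := fun x y h => Or.inr h.1
  have hcount := card_le_of_inf_mem (C ⊔ crossGraph c) (crossGraphOn c Z)
    {G : SimpleGraph V | G ≤ C ∧ ¬ ∃ f : Fin r → V, (∀ i, f i ∈ Z ∧ c (f i) = i) ∧
        ∀ i j, i ≠ j → G.Adj (f i) (f j)}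
    {G : SimpleGraph V | G ≤ crossGraphOn c Z ∧ G.CliqueFree r}
    (fun G hG => (mem_filter.1 hG).2.1.trans le_sup_left) (by
      intro G hG
      refine mem_filter.2 ⟨mem_univ _, inf_le_right, ?_⟩
      -- An r-clique within the r-partite graph on Z meets each class exactly once, hence is
      -- transversal. So the part of G on Z that crosses the classes is K_r-free.
      intro K hK
      refine (mem_filter.1 hG).2.2 ?_
      have hinj : Set.InjOn c K := by
        intro x hx y hy hxy
        by_contra hne
        exact (hK.1 hx hy hne).2.1 hxy
      have himg : K.image c = univ := by
        apply eq_univ_of_card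
        rw [card_image_of_injOn hinj, hK.2, Fintype.card_fin]
      have hex : ∀ i, ∃ x ∈ K, c x = i := fun i => by
        have : i ∈ K.image c := himg ▸ mem_univ i
        simpa using this
      choose f hf1 hf2 using hex
      have hne : ∀ i j, i ≠ j → (G ⊓ crossGraphOn c Z).Adj (f i) (f j) := by
        intro i j hij
        refine hK.1 (hf1 i) (hf1 j) fun h => hij ?_
        rw [← hf2 i, ← hf2 j, h]
      refine ⟨f, fun i => ⟨?_, hf2 i⟩, fun i j hij => (hne i j hij).1⟩
      -- That f i lies in Z is read off from an edge at f i, which needs a second index and hence r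
      -- ≥ 2.
      obtain ⟨j, hj⟩ : ∃ j : Fin r, i ≠ j := by
        have : Nontrivial (Fin r) := Fin.nontrivial_iff_two_le.2 hr
        exact (exists_ne i).imp fun _ h => h.symm
      exact (hne i j hj).2.2.1)
  refine hcount.trans ?_
  refine mul_le_mul ?_ ?_ (Nat.cast_nonneg _) (by positivity)
  · refine Real.rpow_le_rpow_of_exponent_le (by norm_num) ?_
    have h1 := adjPairs_sdiff_add hle
    rw [adjPairs_sup_crossGraph] at h1
    have h2 : (adjPairs ((C ⊔ crossGraph c) \ crossGraphOn c Z) : ℝ) +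
        adjPairs (crossGraphOn c Z) = monoPairs C c + adjPairs (crossGraph c) := by
      exact_mod_cast h1
    have h3 := adjPairs_crossGraphOn c Z b hZ
    linarith
  · have : #{G : SimpleGraph V | G ≤ crossGraphOn c Z ∧ G.CliqueFree r} ≤
        numCliqueFree Z r := by
      rw [numCliqueFree_eq]
      refine card_le_card_of_injOn (fun G => G.comap Subtype.val) ?_ ?_
      · intro G hG
        simp only [coe_filter, mem_univ, true_and, Set.mem_ofPred_eq] at hG ⊢
        exact SimpleGraph.CliqueFree.comap
          ⟨(SimpleGraph.Embedding.comap (Function.Embedding.subtype (· ∈ Z)) G).toCopy⟩ hG.2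
      · intro G hG H hH h
        simp only [coe_filter, mem_univ, true_and, Set.mem_ofPred_eq] at hG hH
        have key : ∀ {G H : SimpleGraph V}, G ≤ crossGraphOn c Z →
            G.comap (Subtype.val : Z → V) = H.comap Subtype.val → G ≤ H := by
          intro G H hG h x y hxy
          have hx := (hG hxy).2
          have : (G.comap (Subtype.val : Z → V)).Adj ⟨x, hx.1⟩ ⟨y, hx.2⟩ := hxy
          rw [h] at this
          exact this
        exact le_antisymm (key hG.1 h) (key hH.1 h.symm)
    exact_mod_cast this

/-- The complete bipartite graph between disjoint sets `X` and `Y`. -/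
def betweenGraph (X Y : Finset V) (h : Disjoint X Y) : SimpleGraph V where
  Adj x y := (x ∈ X ∧ y ∈ Y) ∨ (x ∈ Y ∧ y ∈ X)
  symm := ⟨fun _ _ h => by tauto⟩
  loopless := ⟨fun _ h' => by
    rcases h' with h' | h'
    exacts [disjoint_left.1 h h'.1 h'.2, disjoint_left.1 h h'.2 h'.1]⟩

lemma two_mul_card_mul_card_le_adjPairs (X Y : Finset V) (h : Disjoint X Y) :
    2 * (#X * #Y) ≤ adjPairs (betweenGraph X Y h) := by
  have : #(X ×ˢ Y ∪ Y ×ˢ X) = 2 * (#X * #Y) := by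
    rw [card_union_of_disjoint, card_product, card_product]
    · ring
    · rw [disjoint_left]
      rintro ⟨x, y⟩ h1 h2
      exact disjoint_left.1 h (mem_product.1 h1).1 (mem_product.1 h2).1
  rw [← this]
  refine card_le_card ?_
  rintro ⟨x, y⟩ hp
  simp only [mem_union, mem_product] at hp
  exact mem_filter.2 ⟨mem_univ _, hp⟩

/-- The graphs below `C` with few edges between two subsets of distinct parts are few. -/
lemma card_filter_sparse_le {r : ℕ} (c : V → Fin r) (C : SimpleGraph V) (X Y : Finset V)
    (b : ℕ) (hX : #X = b) (hY : #Y = b) {i j : Fin r} (hij : i ≠ j) (hXi : X ⊆ colorClass c i)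
    (hYj : Y ⊆ colorClass c j) {d : ℝ} (hd : 0 ≤ d) :
    (#{G : SimpleGraph V | G ≤ C ∧ (#(edgesBetween G X Y) : ℝ) ≤ d} : ℝ) ≤
      2 ^ (((monoPairs C c : ℝ) + adjPairs (crossGraph c) - 2 * b ^ 2) / 2) *
        ((Fintype.card V : ℝ) + 1) ^ (2 * d) := by
  have hdisj : Disjoint X Y := by
    rw [disjoint_left]
    intro x hx hy
    exact hij ((mem_colorClass.1 (hXi hx)).symm.trans (mem_colorClass.1 (hYj hy)))
  have hle : betweenGraph X Y hdisj ≤ C ⊔ crossGraph c := by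
    refine fun x y h => Or.inr ?_
    rw [crossGraph_adj]
    rcases h with h | h
    · rw [mem_colorClass.1 (hXi h.1), mem_colorClass.1 (hYj h.2)]
      exact hij
    · rw [mem_colorClass.1 (hXi h.2), mem_colorClass.1 (hYj h.1)]
      exact hij.symm
  have hcount := card_le_of_inf_mem (C ⊔ crossGraph c) (betweenGraph X Y hdisj)
    {G : SimpleGraph V | G ≤ C ∧ (#(edgesBetween G X Y) : ℝ) ≤ d}
    {G : SimpleGraph V | G ≤ betweenGraph X Y hdisj ∧ (#(edgesBetween G X Y) : ℝ) ≤ d}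
    (fun G hG => (mem_filter.1 hG).2.1.trans le_sup_left) (by
      intro G hG
      refine mem_filter.2 ⟨mem_univ _, inf_le_right, le_trans ?_ (mem_filter.1 hG).2.2⟩
      refine Nat.cast_le.2 (card_le_card fun p hp => ?_)
      rw [mem_edgesBetween] at hp ⊢
      exact ⟨hp.1, hp.2.1⟩)
  refine hcount.trans ?_
  refine mul_le_mul ?_ ?_ (Nat.cast_nonneg _) (by positivity)
  · refine Real.rpow_le_rpow_of_exponent_le (by norm_num) ?_
    have h1 := adjPairs_sdiff_add hle
    rw [adjPairs_sup_crossGraph] at h1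
    have h2 : (adjPairs ((C ⊔ crossGraph c) \ betweenGraph X Y hdisj) : ℝ) +
        adjPairs (betweenGraph X Y hdisj) = monoPairs C c + adjPairs (crossGraph c) := by
      exact_mod_cast h1
    have h3 := two_mul_card_mul_card_le_adjPairs X Y hdisj
    rw [hX, hY] at h3
    have h4 : 2 * ((b : ℝ) * b) ≤ adjPairs (betweenGraph X Y hdisj) := by exact_mod_cast h3
    linarith
  · have h1 : #{G : SimpleGraph V | G ≤ betweenGraph X Y hdisj ∧
        (#(edgesBetween G X Y) : ℝ) ≤ d} ≤
        #{T : Finset (V × V) | #T ≤ ⌊d⌋₊} := by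
      refine card_le_card_of_injOn (fun G => edgesBetween G X Y) ?_ ?_
      · intro G hG
        simp only [coe_filter, mem_univ, true_and, Set.mem_ofPred_eq] at hG ⊢
        exact Nat.le_floor hG.2
      · intro G hG H hH h
        simp only [coe_filter, mem_univ, true_and, Set.mem_ofPred_eq] at hG hH
        have key : ∀ {G H : SimpleGraph V}, G ≤ betweenGraph X Y hdisj →
            edgesBetween G X Y = edgesBetween H X Y →
            G ≤ H := by
          intro G H hG h x y hxy
          have hh : ∀ x y, x ∈ X → y ∈ Y → G.Adj x y → H.Adj x y := by
            intro x y hx hy hxy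
            have : (x, y) ∈ edgesBetween G X Y :=
              mem_edgesBetween.2 ⟨mem_product.2 ⟨hx, hy⟩, hxy⟩
            rw [h] at this
            exact (mem_edgesBetween.1 this).2
          rcases hG hxy with hx | hx
          · exact hh x y hx.1 hx.2 hxy
          · exact (hh y x hx.2 hx.1 hxy.symm).symm
        exact le_antisymm (key hG.1 h) (key hH.1 h.symm)
    have h2 := h1.trans (card_filter_card_le _)
    rw [Fintype.card_prod] at h2
    have h3 : (Fintype.card V * Fintype.card V + 1) ^ ⌊d⌋₊ ≤
        ((Fintype.card V + 1) ^ 2) ^ ⌊d⌋₊ := Nat.pow_le_pow_left (by nlinarith) _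
    have h4 : (#{G : SimpleGraph V | G ≤ betweenGraph X Y hdisj ∧
        (#(edgesBetween G X Y) : ℝ) ≤ d} : ℝ) ≤
        ((Fintype.card V : ℝ) + 1) ^ (2 * ⌊d⌋₊) := by
      rw [pow_mul]
      exact_mod_cast h2.trans h3
    refine h4.trans ?_
    rw [← Real.rpow_natCast]
    refine Real.rpow_le_rpow_of_exponent_le ?_ ?_
    · have : (0 : ℝ) ≤ Fintype.card V := Nat.cast_nonneg _
      linarith
    · push_cast
      have := Nat.floor_le hd
      linarith

end Nice

/-! ### Almost every K_{r+1}-free graph has a nice partition -/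

section NotNice

variable {V : Type*} [Fintype V]

/-- A graph for which `c` fails to be nice, although it has few monochromatic edges and no small
part, has no transversal clique in some set or few edges between two sets. -/
lemma exists_of_not_isNice {r : ℕ} {c : V → Fin r} {b : ℕ} {s d : ℝ} {G : SimpleGraph V}
    (hnice : ¬ IsNice G c b s d)
    (hcard : ∀ i, (Fintype.card V : ℝ) / r - s ≤ #(colorClass c i))
    (hmono : (monoPairs G c : ℝ) ≤ d) :
    (∃ Z : Finset V, (∀ i, #{x ∈ Z | c x = i} = b) ∧
      ¬ ∃ f : Fin r → V, (∀ i, f i ∈ Z ∧ c (f i) = i) ∧ ∀ i j, i ≠ j → G.Adj (f i) (f j)) ∨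
    ∃ X Y : Finset V, (#X = b ∧ #Y = b ∧ ∃ i j, i ≠ j ∧ X ⊆ colorClass c i ∧ Y ⊆ colorClass c j) ∧
      (#(edgesBetween G X Y) : ℝ) ≤ 2 * d := by
  by_contra hcon
  rw [not_or] at hcon
  refine hnice ⟨hcard, ?_, hmono, ?_⟩
  · intro B hB hb
    choose B' hB' hB'card using fun i => exists_subset_card_eq (hb i)
    have hmem : ∀ i x, x ∈ B' i → c x = i := fun i x hx => mem_colorClass.1 (hB i (hB' i hx))
    by_contra hno
    refine hcon.1 ⟨univ.biUnion B', fun i => ?_, fun ⟨f, hf, hadj⟩ => hno ⟨f, fun i => ?_, hadj⟩⟩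
    · rw [← hB'card i]
      congr 1
      ext x
      simp only [mem_filter, mem_biUnion, mem_univ, true_and]
      constructor
      · rintro ⟨⟨j, hj⟩, hi⟩
        rw [hmem j x hj] at hi
        exact hi ▸ hj
      · exact fun hx => ⟨⟨i, hx⟩, hmem i x hx⟩
    · obtain ⟨j, -, hj⟩ := mem_biUnion.1 (hf i).1
      have : j = i := (hmem j _ hj).symm.trans (hf i).2
      exact hB' i (this ▸ hj)
  · intro i j hij X hX Y hY hbX hbY
    obtain ⟨X', hX', hX'c⟩ := exists_subset_card_eq hbX
    obtain ⟨Y', hY', hY'c⟩ := exists_subset_card_eq hbY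
    by_contra hle
    rw [not_lt] at hle
    refine hcon.2 ⟨X', Y', ⟨hX'c, hY'c, i, j, hij, hX'.trans hX, hY'.trans hY⟩, le_trans ?_ hle⟩
    refine Nat.cast_le.2 (card_le_card fun p hp => ?_)
    rw [mem_edgesBetween] at hp ⊢
    exact ⟨product_subset_product hX' hY' hp.1, hp.2⟩

/-- Counting the subgraphs of `C` for which `c` fails to be nice. -/
lemma card_filter_not_isNice_le {r : ℕ} (hr : 2 ≤ r) {c : V → Fin r} {b : ℕ} {s d β γ : ℝ}
    (C : SimpleGraph V) (hd : 0 ≤ d)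
    (hcard : ∀ i, (Fintype.card V : ℝ) / r - s ≤ #(colorClass c i))
    (hmono : (monoPairs C c : ℝ) ≤ d)
    (hβ : ∀ Z : Finset V, (∀ i, #{x ∈ Z | c x = i} = b) →
      2 ^ ((d + adjPairs (crossGraph c) - r * (r - 1) * b ^ 2) / 2) *
        (numCliqueFree Z r : ℝ) ≤ β)
    (hγ : (2 : ℝ) ^ ((d + adjPairs (crossGraph c) - 2 * b ^ 2) / 2) *
        ((Fintype.card V : ℝ) + 1) ^ (2 * (2 * d)) ≤ γ) (hβ0 : 0 ≤ β) :
    (#{G : SimpleGraph V | G ≤ C ∧ ¬ IsNice G c b s d} : ℝ) ≤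
      2 ^ Fintype.card V * β + 2 ^ Fintype.card V * 2 ^ Fintype.card V * γ := by
  have hγ0 : 0 ≤ γ := le_trans (by positivity) hγ
  let P : Finset V → Finset (SimpleGraph V) := fun Z =>
    {G : SimpleGraph V | (∀ i, #{x ∈ Z | c x = i} = b) ∧ G ≤ C ∧
      ¬ ∃ f : Fin r → V, (∀ i, f i ∈ Z ∧ c (f i) = i) ∧ ∀ i j, i ≠ j → G.Adj (f i) (f j)}
  let Q : Finset V × Finset V → Finset (SimpleGraph V) := fun q =>
    {G : SimpleGraph V | (#q.1 = b ∧ #q.2 = b ∧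
      ∃ i j, i ≠ j ∧ q.1 ⊆ colorClass c i ∧ q.2 ⊆ colorClass c j) ∧
      G ≤ C ∧ (#(edgesBetween G q.1 q.2) : ℝ) ≤ 2 * d}
  have hP : ∀ Z, (#(P Z) : ℝ) ≤ β := by
    intro Z
    by_cases hZ : ∀ i, #{x ∈ Z | c x = i} = b
    · refine le_trans ?_ (hβ Z hZ)
      have h1 := card_filter_no_transversal_le hr c C Z b hZ
      simp only [P, hZ, implies_true, true_and]
      refine h1.trans (mul_le_mul_of_nonneg_right ?_ (Nat.cast_nonneg _))
      exact Real.rpow_le_rpow_of_exponent_le (by norm_num) (by linarith)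
    · have : P Z = ∅ := filter_eq_empty_iff.2 fun G _ h => hZ h.1
      rw [this]
      simpa using hβ0
  have hQ : ∀ q, (#(Q q) : ℝ) ≤ γ := by
    intro q
    by_cases hq : #q.1 = b ∧ #q.2 = b ∧
      ∃ i j, i ≠ j ∧ q.1 ⊆ colorClass c i ∧ q.2 ⊆ colorClass c j
    · obtain ⟨h1, h2, i, j, hij, h3, h4⟩ := hq
      refine le_trans ?_ hγ
      have h5 := card_filter_sparse_le c C q.1 q.2 b h1 h2 hij h3 h4
        (mul_nonneg zero_le_two hd)
      have h6 : (#(Q q) : ℝ) ≤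
          #{G : SimpleGraph V | G ≤ C ∧ (#(edgesBetween G q.1 q.2) : ℝ) ≤ 2 * d} := by
        refine Nat.cast_le.2 (card_le_card fun G hG => ?_)
        exact mem_filter.2 ⟨mem_univ _, (mem_filter.1 hG).2.2⟩
      refine (h6.trans h5).trans (mul_le_mul_of_nonneg_right ?_ (by positivity))
      exact Real.rpow_le_rpow_of_exponent_le (by norm_num) (by linarith)
    · have : Q q = ∅ := filter_eq_empty_iff.2 fun G _ h => hq h.1
      rw [this]
      simpa using hγ0
  have hsub : ({G : SimpleGraph V | G ≤ C ∧ ¬ IsNice G c b s d} : Finset (SimpleGraph V)) ⊆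
      univ.biUnion P ∪ univ.biUnion Q := by
    intro G hG
    obtain ⟨hGC, hGn⟩ := (mem_filter.1 hG).2
    have hm : (monoPairs G c : ℝ) ≤ d :=
      le_trans (Nat.cast_le.2 (monoPairs_mono hGC c)) hmono
    rcases exists_of_not_isNice hGn hcard hm with ⟨Z, hZ, hno⟩ | ⟨X, Y, hXY, hle⟩
    · exact mem_union_left _ (mem_biUnion.2 ⟨Z, mem_univ _, mem_filter.2 ⟨mem_univ _, hZ, hGC, hno⟩⟩)
    · exact mem_union_right _ (mem_biUnion.2 ⟨(X, Y), mem_univ _,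
        mem_filter.2 ⟨mem_univ _, hXY, hGC, hle⟩⟩)
  have h1 : (#(univ.biUnion P) : ℝ) ≤ 2 ^ Fintype.card V * β := by
    have : (#(univ.biUnion P) : ℝ) ≤ ∑ Z, (#(P Z) : ℝ) := by exact_mod_cast card_biUnion_le
    refine this.trans ((sum_le_sum fun Z _ => hP Z).trans (le_of_eq ?_))
    rw [sum_const, card_univ, Fintype.card_finset, nsmul_eq_mul]
    push_cast
    rfl
  have h2 : (#(univ.biUnion Q) : ℝ) ≤ 2 ^ Fintype.card V * 2 ^ Fintype.card V * γ := by
    have : (#(univ.biUnion Q) : ℝ) ≤ ∑ q, (#(Q q) : ℝ) := by exact_mod_cast card_biUnion_le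
    refine this.trans ((sum_le_sum fun q _ => hQ q).trans (le_of_eq ?_))
    rw [sum_const, card_univ, Fintype.card_prod, Fintype.card_finset, nsmul_eq_mul]
    push_cast
    rfl
  have h3 : (#{G : SimpleGraph V | G ≤ C ∧ ¬ IsNice G c b s d} : ℝ) ≤
      #(univ.biUnion P) + #(univ.biUnion Q) := by
    exact_mod_cast (card_le_card hsub).trans (card_union_le _ _)
  linarith

/-- On rb vertices the Turán count for r - 1 parts falls short of the r(r - 1)b² crossing pairs by
(1 + 1/(r - 1))b². Since b² ≥ L³q, half of this outweighs the allowance Lq for monochromatic pairs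
and the counting error. -/
lemma transversal_exponent_le {r L b q t x : ℝ} (hr : 2 ≤ r) (hrL : r ≤ L) (hL : 100 ≤ L)
    (hq : 0 ≤ q) (hx : x ≤ 2 * t) (hb : L ^ 3 * q ≤ b ^ 2) :
    (L * q + x - r * (r - 1) * b ^ 2) / 2 +
      ((1 - 1 / (r - 1)) * (r * b) ^ 2 / 2 + 3 * (r * b) ^ 2 / L ^ 11) ≤ t - 5 * q := by
  have hL0 : 0 < L := by linarith
  have hgain : (1 - 1 / (r - 1)) * (r * b) ^ 2 = r * (r - 1) * b ^ 2 -
      (1 + 1 / (r - 1)) * b ^ 2 := by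
    have : r - 1 ≠ 0 := by linarith
    field_simp
    ring
  have hinv : 0 ≤ 1 / (r - 1) * b ^ 2 := by
    have : 0 ≤ r - 1 := by linarith
    positivity
  have herr : 3 * (r * b) ^ 2 / L ^ 11 ≤ b ^ 2 / 4 := by
    rw [div_le_iff₀ (by positivity)]
    have h1 : r ^ 2 ≤ L ^ 2 := pow_le_pow_left₀ (by linarith) hrL 2
    have h2 : 12 * L ^ 2 ≤ L ^ 11 := by
      have h4 : L ^ 3 ≤ L ^ 11 := pow_le_pow_right₀ (by linarith) (by norm_num)
      have h5 : 12 * L ^ 2 ≤ L * L ^ 2 := mul_le_mul_of_nonneg_right (by linarith) (by positivity)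
      linarith
    have h3 : 12 * r ^ 2 ≤ L ^ 11 := by linarith
    have h4 := mul_le_mul_of_nonneg_right h3 (sq_nonneg b)
    linarith
  have hL3 : 2 * L + 40 ≤ L ^ 3 := by nlinarith [mul_pos hL0 hL0]
  have hL3q := mul_le_mul_of_nonneg_right hL3 hq
  rw [hgain]
  linarith

/-- The term 4L²q pays for listing the few edges between two sets of size b. Losing b² ≥ L³q free
pairs more than compensates. -/
lemma sparse_exponent_le {L b q t x : ℝ} (hL : 100 ≤ L) (hq : 0 ≤ q) (hx : x ≤ 2 * t)
    (hb : L ^ 3 * q ≤ b ^ 2) :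
    (L * q + x - 2 * b ^ 2) / 2 + 4 * L ^ 2 * q ≤ t - 5 * q := by
  have hL0 : 0 < L := by linarith
  have hL3 : 8 * L ^ 2 + 2 * L + 40 ≤ L ^ 3 := by nlinarith [mul_pos hL0 hL0]
  have hL3q := mul_le_mul_of_nonneg_right hL3 hq
  have h1 : 0 ≤ L ^ 2 * q := by positivity
  have h2 : 0 ≤ L * q := by positivity
  linarith

/-- Each fixed obstruction saves 5q in the exponent. Since the vertex count is at most q, the union
over single sets and pairs of sets costs at most 2q and a factor 2. The remaining 2q still beats the
container loss, which is q in the application. -/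
lemma card_filter_not_isNice_le_rpow {r L : ℕ} (hr : 2 ≤ r) (hrL : r ≤ L) (hL : 100 ≤ L)
    (hm : Fintype.card V + 1 ≤ 2 ^ L) {b : ℕ} (hb : (L : ℝ) ^ (24 + 28 * (r - 1)) ≤ b)
    {q s t : ℝ} (hmq : (Fintype.card V : ℝ) ≤ q) (hq1 : 1 ≤ q) (hb2 : (L : ℝ) ^ 3 * q ≤ (b : ℝ) ^ 2)
    {c : V → Fin r} (hcross : (adjPairs (crossGraph c) : ℝ) ≤ 2 * t) (C : SimpleGraph V)
    (hmono : (monoPairs C c : ℝ) ≤ L * q)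
    (hcard : ∀ i, (Fintype.card V : ℝ) / r - s ≤ #(colorClass c i)) :
    (#{G : SimpleGraph V | G ≤ C ∧ ¬ IsNice G c b s (L * q)} : ℝ) ≤ 2 ^ (t - 2 * q) := by
  have hL1 : (100 : ℝ) ≤ L := by exact_mod_cast hL
  have hdq : 0 ≤ L * q := by positivity
  have hbound := card_filter_not_isNice_le hr (b := b) (β := 2 ^ (t - 5 * q))
    (γ := 2 ^ (t - 5 * q)) C hdq hcard hmono ?_ ?_ (by positivity)
  · refine hbound.trans ?_
    have hp : (2 : ℝ) ^ Fintype.card V ≤ 2 ^ q := by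
      rw [← Real.rpow_natCast]
      exact Real.rpow_le_rpow_of_exponent_le (by norm_num) hmq
    have e1 : (2 : ℝ) ^ Fintype.card V * 2 ^ (t - 5 * q) ≤ 2 ^ (t - 3 * q) := by
      calc _ ≤ (2 : ℝ) ^ q * 2 ^ (t - 5 * q) := by gcongr
        _ = 2 ^ (t - 4 * q) := by rw [← Real.rpow_add (by norm_num)]; congr 1; ring
        _ ≤ _ := Real.rpow_le_rpow_of_exponent_le (by norm_num) (by linarith)
    have e2 : (2 : ℝ) ^ Fintype.card V * 2 ^ Fintype.card V * 2 ^ (t - 5 * q) ≤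
        2 ^ (t - 3 * q) := by
      calc _ ≤ (2 : ℝ) ^ q * 2 ^ q * 2 ^ (t - 5 * q) := by gcongr
        _ = 2 ^ (t - 3 * q) := by
          rw [← Real.rpow_add (by norm_num), ← Real.rpow_add (by norm_num)]; congr 1; ring
    have e3 : 2 * (2 : ℝ) ^ (t - 3 * q) ≤ 2 ^ (t - 2 * q) := by
      calc 2 * (2 : ℝ) ^ (t - 3 * q) = 2 ^ (1 + (t - 3 * q)) := by
            rw [Real.rpow_add (by norm_num), Real.rpow_one]
        _ ≤ _ := Real.rpow_le_rpow_of_exponent_le (by norm_num) (by linarith)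
    linarith
  · intro Z hZ
    have hZcard : (Fintype.card Z : ℝ) = r * b := by
      have : #Z = ∑ i : Fin r, #{x ∈ Z | c x = i} :=
        card_eq_sum_card_fiberwise fun _ _ => mem_univ _
      rw [Fintype.card_coe, this]
      simp [hZ]
    have hZm : Fintype.card Z ≤ Fintype.card V := Fintype.card_subtype_le _
    have hcl := card_cliqueFree_le (V := Z) (r := r - 1) (L := L) (by omega) (by omega) (by omega)
      (by omega) (by
        have h1 : (L : ℝ) ^ (24 + 28 * (r - 1)) ≤ Fintype.card Z := by
          rw [hZcard]
          have h3 : (1 : ℝ) ≤ r := by exact_mod_cast (by omega : 1 ≤ r)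
          have h4 : (0 : ℝ) ≤ b := Nat.cast_nonneg _
          nlinarith
        exact_mod_cast h1)
    rw [Nat.sub_add_cancel (by omega : 1 ≤ r), hZcard] at hcl
    refine (mul_le_mul_of_nonneg_left hcl (by positivity)).trans ?_
    rw [← Real.rpow_add (by norm_num)]
    refine Real.rpow_le_rpow_of_exponent_le (by norm_num) ?_
    have hr2 : (2 : ℝ) ≤ r := by exact_mod_cast hr
    have hcast : ((r - 1 : ℕ) : ℝ) = r - 1 := by push_cast [Nat.cast_sub (by omega : 1 ≤ r)]; ring
    rw [hcast]
    exact transversal_exponent_le hr2 (by exact_mod_cast hrL) hL1 (by linarith) (by linarith) hb2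
  · have hm2 : ((Fintype.card V : ℝ) + 1) ^ (2 * (2 * (L * q))) ≤ (2 : ℝ) ^ (4 * L ^ 2 * q) := by
      have h1 : (Fintype.card V : ℝ) + 1 ≤ (2 : ℝ) ^ (L : ℝ) := by
        rw [Real.rpow_natCast]
        exact_mod_cast hm
      refine (Real.rpow_le_rpow (by positivity) h1 (by positivity)).trans (le_of_eq ?_)
      rw [← Real.rpow_mul (by norm_num)]
      congr 1
      ring
    refine (mul_le_mul_of_nonneg_left hm2 (by positivity)).trans ?_
    rw [← Real.rpow_add (by norm_num)]
    refine Real.rpow_le_rpow_of_exponent_le (by norm_num) ?_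
    exact sparse_exponent_le hL1 (by linarith) (by linarith) hb2

/-- Almost all `K_{r+1}`-free graphs have a nice partition. -/
theorem card_filter_forall_not_isNice_le {r L : ℕ} (hr : 2 ≤ r) (hrL : r ≤ L) (hL : 100 ≤ L)
    (hm : Fintype.card V + 1 ≤ 2 ^ L) (hLm : L ^ (24 + 28 * r) ≤ Fintype.card V) :
    (#{G : SimpleGraph V | G.CliqueFree (r + 1) ∧ ∀ c : V → Fin r,
        ¬ IsNice G c ⌈(Fintype.card V : ℝ) / L ^ 4⌉₊ ((Fintype.card V : ℝ) / L ^ 2)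
          ((Fintype.card V : ℝ) ^ 2 / L ^ 10)} : ℝ) ≤
      2 ^ ((1 - 1 / (r : ℝ)) * (Fintype.card V : ℝ) ^ 2 / 2 - (Fintype.card V : ℝ) ^ 2 / L ^ 11) := by
  set m : ℝ := (Fintype.card V : ℝ) with hmdef
  set b : ℕ := ⌈m / (L : ℝ) ^ 4⌉₊ with hb
  set q : ℝ := m ^ 2 / (L : ℝ) ^ 11 with hq
  set t : ℝ := (1 - 1 / (r : ℝ)) * m ^ 2 / 2 with ht
  have hL1 : (100 : ℝ) ≤ L := by exact_mod_cast hL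
  have hL0 : (0 : ℝ) < L := by linarith
  have hLm' : (L : ℝ) ^ (24 + 28 * r) ≤ m := by rw [hmdef]; exact_mod_cast hLm
  have hm0 : 0 < m := lt_of_lt_of_le (by positivity) hLm'
  have hL11 : (L : ℝ) ^ 11 ≤ m := (pow_le_pow_right₀ (by linarith) (by omega)).trans hLm'
  have hmq : m ≤ q := by
    rw [hq, le_div_iff₀ (by positivity)]
    nlinarith
  have hq1 : 1 ≤ q := by
    have : (1 : ℝ) ≤ (L : ℝ) ^ 11 := one_le_pow₀ (by linarith)
    linarith
  have hd : m ^ 2 / (L : ℝ) ^ 10 = L * q := by rw [hq]; field_simp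
  have hs2 : (m / (L : ℝ) ^ 2) ^ 2 = L ^ 7 * q := by rw [hq]; field_simp
  have hbm : m / (L : ℝ) ^ 4 ≤ b := Nat.le_ceil _
  have hb2 : (L : ℝ) ^ 3 * q ≤ (b : ℝ) ^ 2 := by
    have h1 : (m / (L : ℝ) ^ 4) ^ 2 = L ^ 3 * q := by rw [hq]; field_simp
    rw [← h1]
    exact pow_le_pow_left₀ (by positivity) hbm 2
  rw [hd]
  have hdq : 0 ≤ L * q := by positivity
  obtain ⟨C, hC, hcount⟩ := exists_poor_container_pow (by omega) hrL (by omega) hm hLm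
    ({G : SimpleGraph V | G.CliqueFree (r + 1) ∧ ∀ c : V → Fin r,
        ¬ IsNice G c b (m / L ^ 2) (L * q)}) (fun G hG => (mem_filter.1 hG).2.1)
  rw [← hmdef, ← hq] at hcount
  obtain ⟨c, hc⟩ := exists_fin_coloring_of_not_rich (by omega) C (by positivity) hC
  have hcross := adjPairs_crossGraph_le (by omega) c
  rw [← hmdef] at hc hcross
  have hθ : 2 * (r + 1) * (m / L ^ 12) * m ≤ 4 * q := by
    have hr1 : (r : ℝ) + 1 ≤ 2 * L := by
      have : r + 1 ≤ 2 * L := by omega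
      exact_mod_cast this
    have e : 2 * ((r : ℝ) + 1) * (m / L ^ 12) * m = 2 * ((r + 1) / L) * q := by
      rw [hq]; field_simp
    rw [e]
    have : ((r : ℝ) + 1) / L ≤ 2 := by rw [div_le_iff₀ hL0]; exact hr1
    nlinarith
  suffices hmain : (#{G ∈ ({G : SimpleGraph V | G.CliqueFree (r + 1) ∧ ∀ c : V → Fin r,
        ¬ IsNice G c b (m / L ^ 2) (L * q)} : Finset (SimpleGraph V)) | G ≤ C} : ℝ) ≤
      2 ^ (t - 2 * q) by
    refine (hcount.trans (mul_le_mul_of_nonneg_left hmain (by positivity))).trans (le_of_eq ?_)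
    rw [← Real.rpow_add (by norm_num)]
    congr 1
    ring
  have hall : (adjPairs C : ℝ) / 2 ≤ t - 2 * q →
      (#{G ∈ ({G : SimpleGraph V | G.CliqueFree (r + 1) ∧ ∀ c : V → Fin r,
        ¬ IsNice G c b (m / L ^ 2) (L * q)} : Finset (SimpleGraph V)) | G ≤ C} : ℝ) ≤
      2 ^ (t - 2 * q) := by
    intro hle
    refine le_trans ?_ ((card_le_card_filter_le C).trans
      (Real.rpow_le_rpow_of_exponent_le (by norm_num) hle))
    exact_mod_cast card_le_card (filter_subset_filter _ (subset_univ _))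
  -- A container with many monochromatic pairs, or with an undersized class, has so few edges that
  -- all its subgraphs together are negligible. Otherwise niceness fails only through missing
  -- transversals or sparse pairs in the individual graphs.
  by_cases hmono : (monoPairs C c : ℝ) ≤ L * q
  swap
  · apply hall
    rw [not_le] at hmono
    nlinarith
  by_cases hcard : ∀ i, m / r - m / L ^ 2 ≤ #(colorClass c i)
  swap
  · apply hall
    push Not at hcard
    obtain ⟨i, hi⟩ := hcard
    have h1 := adjPairs_crossGraph_le_of_lt (by omega) c (by positivity) i hi
    rw [← hmdef, hs2] at h1
    have h2 : (adjPairs C : ℝ) ≤ monoPairs C c + adjPairs (crossGraph c) := by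
      rw [← Nat.cast_add, ← adjPairs_sup_crossGraph]
      exact Nat.cast_le.2 (adjPairs_mono le_sup_left)
    have h3 : (L : ℝ) + 4 ≤ L ^ 7 := by
      have : (L : ℝ) ^ 2 ≤ L ^ 7 := pow_le_pow_right₀ (by linarith) (by norm_num)
      nlinarith
    have h4 := mul_le_mul_of_nonneg_right h3 (by linarith : (0 : ℝ) ≤ q)
    linarith
  have hbL : (L : ℝ) ^ (24 + 28 * (r - 1)) ≤ b := by
    refine le_trans ?_ hbm
    rw [le_div_iff₀ (by positivity), ← pow_add]
    exact (pow_le_pow_right₀ (by linarith) (by omega)).trans hLm'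
  refine le_trans (Nat.cast_le.2 (card_le_card fun G hG => ?_))
    (card_filter_not_isNice_le_rpow hr hrL hL hm hbL hmq hq1 hb2 (by linarith) C hmono hcard)
  rw [mem_filter, mem_filter] at hG
  exact mem_filter.2 ⟨mem_univ _, hG.2, hG.1.2.2 c⟩

end NotNice

/-! ### Uniqueness of nice partitions and the local structure of bad edges -/

section Structure

variable {V : Type*} [Fintype V]

/-- A partition that is nice for `G` essentially agrees with every partition with few
monochromatic edges. -/
lemma IsNice.exists_bijective {r b : ℕ} {s d : ℝ} {G : SimpleGraph V} {c : V → Fin r}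
    (h : IsNice G c b s d) (hb : ∀ i, r * b ≤ #(colorClass c i)) (c' : V → Fin r)
    (hc' : (monoPairs G c' : ℝ) ≤ 2 * d) :
    ∃ k : Fin r → Fin r, Function.Bijective k ∧
      ∀ j, #{x ∈ colorClass c j | c' x ≠ k j} ≤ r * b := by
  have hsum : ∀ j, #(colorClass c j) = ∑ i, #{x ∈ colorClass c j | c' x = i} := fun j =>
    card_eq_sum_card_fiberwise fun _ _ => mem_univ _
  have hbig : ∀ j, ∃ i, b ≤ #{x ∈ colorClass c j | c' x = i} := by
    intro j
    by_contra hcon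
    push Not at hcon
    have hlt : ∑ i, #{x ∈ colorClass c j | c' x = i} < ∑ _i : Fin r, b :=
      sum_lt_sum_of_nonempty ⟨j, mem_univ _⟩ fun i _ => hcon i
    rw [← hsum, sum_const, card_univ, Fintype.card_fin, smul_eq_mul] at hlt
    exact absurd (hb j) (not_le.2 hlt)
  -- If two classes of c both had a large share of colour i, the more than 2d edges between these
  -- shares would be monochromatic under c'.
  have hone : ∀ i j j', j ≠ j' → b ≤ #{x ∈ colorClass c j | c' x = i} →
      b ≤ #{x ∈ colorClass c j' | c' x = i} → False := by
    intro i j j' hj h1 h2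
    have h3 := h.lt_card j j' hj _ (filter_subset _ _) _ (filter_subset _ _) h1 h2
    have h4 : #(edgesBetween G {x ∈ colorClass c j | c' x = i} {x ∈ colorClass c j' | c' x = i}) ≤
        monoPairs G c' := by
      refine card_le_card fun p hp => ?_
      rw [mem_edgesBetween, mem_product, mem_filter, mem_filter] at hp
      simp only [mem_filter, mem_univ, true_and]
      exact ⟨hp.2, hp.1.1.2.trans hp.1.2.2.symm⟩
    have h5 : (#(edgesBetween G {x ∈ colorClass c j | c' x = i}
        {x ∈ colorClass c j' | c' x = i}) : ℝ) ≤ monoPairs G c' := Nat.cast_le.2 h4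
    linarith
  choose k hk using hbig
  have hinj : Function.Injective k := by
    intro j j' hjj'
    by_contra hne
    exact hone (k j) j j' hne (hk j) (hjj' ▸ hk j')
  have hbij := Finite.injective_iff_bijective.1 hinj
  refine ⟨k, hbij, fun j => ?_⟩
  have h1 : #{x ∈ colorClass c j | c' x ≠ k j} ≤
      ∑ i ∈ univ.erase (k j), #{x ∈ colorClass c j | c' x = i} := by
    refine le_trans (card_le_card ?_) card_biUnion_le
    intro x hx
    rw [mem_filter] at hx
    exact mem_biUnion.2 ⟨c' x, mem_erase.2 ⟨hx.2, mem_univ _⟩, mem_filter.2 ⟨hx.1, rfl⟩⟩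
  refine h1.trans ?_
  refine (sum_le_card_nsmul _ _ b fun i hi => ?_).trans ?_
  · obtain ⟨j', rfl⟩ := hbij.2 i
    have hne : j ≠ j' := fun h => (mem_erase.1 hi).1 (by rw [h])
    by_contra hlt
    exact hone _ j j' hne (by omega) (hk j')
  · rw [smul_eq_mul]
    refine Nat.mul_le_mul_right _ ((card_erase_le).trans ?_)
    simp

/-- A clique-free graph with a nice partition that is not `r`-colourable has an edge both of whose
ends have few neighbours in the same part. -/
lemma IsNice.exists_adj {r b : ℕ} {s d : ℝ} {G : SimpleGraph V} {c : V → Fin r}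
    (h : IsNice G c b s d) (hfree : G.CliqueFree (r + 1)) (hcol : ¬ G.Colorable r) :
    ∃ x y i, G.Adj x y ∧ #(nbrsIn G x (colorClass c i)) < b ∧
      #(nbrsIn G y (colorClass c i)) < b := by
  -- Otherwise the neighbourhood of v contains a transversal r-clique, which v extends. Colouring
  -- each vertex by such a part cannot be proper, and an edge where it fails is the one sought.
  have hτ : ∀ v, ∃ i, #(nbrsIn G v (colorClass c i)) < b := by
    intro v
    by_contra hcon
    push Not at hcon
    obtain ⟨f, hf, hadj⟩ := h.transversal (fun i => nbrsIn G v (colorClass c i))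
      (fun i => nbrsIn_subset _ _ _) hcon
    have hclique : G.IsNClique r (univ.image f) := by
      refine ⟨?_, ?_⟩
      · intro a ha b hb hab
        simp only [coe_image, coe_univ, Set.image_univ, Set.mem_range] at ha hb
        obtain ⟨i, rfl⟩ := ha
        obtain ⟨j, rfl⟩ := hb
        exact hadj i j fun h => hab (by rw [h])
      · rw [card_image_of_injective, card_univ, Fintype.card_fin]
        intro i j hij
        by_contra hne
        exact (hadj i j hne).ne hij
    refine hfree _ (hclique.insert (a := v) fun x hx => ?_)
    obtain ⟨i, -, rfl⟩ := mem_image.1 hx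
    exact (mem_nbrsIn.1 (hf i)).2
  choose τ hτ using hτ
  by_contra hcon
  push Not at hcon
  refine hcol ⟨SimpleGraph.Coloring.mk τ fun {x y} hxy hne => ?_⟩
  have := hcon x y (τ x) hxy (hτ x)
  rw [hne] at this
  exact absurd (hτ y) (not_lt.2 this)

/-- The ends of an edge have few common neighbours in some part other than a given one. -/
lemma IsNice.exists_card_inter_lt {V W : Type*} [Fintype W] {r b : ℕ} {s d : ℝ} {G : SimpleGraph V}
    {φ : W ↪ V} {c : W → Fin r} (h : IsNice (G.comap φ) c b s d) (hb : ∀ i, b ≤ #(colorClass c i))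
    (hfree : G.CliqueFree (r + 1)) {x y : V} (hxy : G.Adj x y) (i : Fin r) :
    ∃ j, i ≠ j ∧ #{w ∈ colorClass c j | G.Adj x (φ w) ∧ G.Adj y (φ w)} < b := by
  by_contra hcon
  push Not at hcon
  obtain ⟨f, hf, hadj⟩ := h.transversal
    -- Part i is only a filler, since `transversal` asks for a set in every part. The vertex found
    -- there is discarded, and x and y extend the remaining (r - 1)-clique.
    (fun j => if i = j then colorClass c j else
      {w ∈ colorClass c j | G.Adj x (φ w) ∧ G.Adj y (φ w)})
    (fun j => by
      split_ifs
      exacts [Subset.refl _, filter_subset _ _])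
    (fun j => by
      split_ifs with hij
      exacts [hb j, hcon j hij])
  have hfj : ∀ j, i ≠ j → G.Adj x (φ (f j)) ∧ G.Adj y (φ (f j)) := by
    intro j hij
    have := hf j
    rw [if_neg hij] at this
    exact (mem_filter.1 this).2
  have hclique : G.IsNClique (r - 1) ((univ.erase i).image fun j => φ (f j)) := by
    refine ⟨?_, ?_⟩
    · intro a ha b hb hab
      obtain ⟨j, -, rfl⟩ := mem_image.1 (mem_coe.1 ha)
      obtain ⟨j', -, rfl⟩ := mem_image.1 (mem_coe.1 hb)
      exact hadj j j' fun h => hab (by rw [h])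
    · rw [card_image_of_injective, card_erase_of_mem (mem_univ _), card_univ, Fintype.card_fin]
      intro j j' hij
      by_contra hne
      exact (hadj j j' hne).ne (φ.injective hij)
  have h1 := hclique.insert (a := y) fun z hz => by
    obtain ⟨j, hj, rfl⟩ := mem_image.1 hz
    exact (hfj j (mem_erase.1 hj).1.symm).2
  have h2 := h1.insert (a := x) fun z hz => by
    rcases mem_insert.1 hz with rfl | hz
    · exact hxy
    · obtain ⟨j, hj, rfl⟩ := mem_image.1 hz
      exact (hfj j (mem_erase.1 hj).1.symm).1
  have hr : 0 < r := i.pos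
  rw [show r - 1 + 1 + 1 = r + 1 by omega] at h2
  exact hfree _ h2

/-- The number of pairs of sets that are both small on `P` and have small intersection on `Q`. -/
lemma card_filter_pairs_le (P Q : Finset V) (hPQ : Disjoint P Q) (k : ℕ) :
    #{p : Finset V × Finset V | #(p.1 ∩ P) ≤ k ∧ #(p.2 ∩ P) ≤ k ∧ #(p.1 ∩ p.2 ∩ Q) ≤ k} ≤
      (Fintype.card V + 1) ^ (3 * k) * (3 ^ #Q * 4 ^ (Fintype.card V - #P - #Q)) := by
  let S : Finset (Finset V) := {T : Finset V | #T ≤ k}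
  -- Apart from three exceptional sets of size at most k, a vertex of P lies in neither set and a
  -- vertex of Q not in both: 1, 3 and 4 options per vertex of P, Q and the rest.
  let vals : V → Finset (Bool × Bool) := fun w =>
    if w ∈ P then {(false, false)} else if w ∈ Q then univ.erase (true, true) else univ
  let enc : Finset V × Finset V → V → Bool × Bool := fun p w =>
    if w ∈ P then (false, false) else if w ∈ Q ∧ w ∈ p.1 ∧ w ∈ p.2 then (false, false) else
      (decide (w ∈ p.1), decide (w ∈ p.2))
  have hcard : #(Fintype.piFinset vals) = 3 ^ #Q * 4 ^ (Fintype.card V - #P - #Q) := by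
    rw [Fintype.card_piFinset]
    have h1 : ∀ w, #(vals w) = if w ∈ P then 1 else if w ∈ Q then 3 else 4 := by
      intro w
      simp only [vals]
      split_ifs
      · simp
      · rw [card_erase_of_mem (mem_univ _)]; rfl
      · rfl
    simp only [h1]
    have hu : (univ : Finset V) = P ∪ (Q ∪ (univ \ (P ∪ Q))) := by
      ext w
      simp only [mem_univ, mem_union, mem_sdiff, true_and, true_iff]
      tauto
    have hd1 : Disjoint Q (univ \ (P ∪ Q)) := by
      rw [disjoint_left]; intro w hw hw'
      simp [hw] at hw'
    have hd2 : Disjoint P (Q ∪ (univ \ (P ∪ Q))) := by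
      rw [disjoint_left]; intro w hw hw'
      rcases mem_union.1 hw' with h | h
      · exact disjoint_left.1 hPQ hw h
      · simp [hw] at h
    have hrest : #(univ \ (P ∪ Q)) = Fintype.card V - #P - #Q := by
      rw [card_sdiff_of_subset (subset_univ _), card_union_of_disjoint hPQ, card_univ, Nat.sub_sub]
    rw [hu, prod_union hd2, prod_union hd1, ← hrest]
    rw [prod_congr rfl (g := fun _ => 1) fun w hw => if_pos hw,
      prod_congr (s₁ := Q) rfl (g := fun _ => 3) fun w hw => by
        rw [if_neg (disjoint_right.1 hPQ hw), if_pos hw],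
      prod_congr (s₁ := univ \ (P ∪ Q)) rfl (g := fun _ => 4) fun w hw => by
        rw [mem_sdiff, mem_union] at hw
        rw [if_neg (by tauto), if_neg (by tauto)]]
    simp
  have hle : #{p : Finset V × Finset V | #(p.1 ∩ P) ≤ k ∧ #(p.2 ∩ P) ≤ k ∧ #(p.1 ∩ p.2 ∩ Q) ≤ k} ≤
      #((S ×ˢ S ×ˢ S) ×ˢ Fintype.piFinset vals) := by
    refine card_le_card_of_injOn
      (fun p => ((p.1 ∩ P, p.2 ∩ P, p.1 ∩ p.2 ∩ Q), enc p)) ?_ ?_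
    · intro p hp
      have hp' := (mem_filter.1 (mem_coe.1 hp)).2
      refine mem_coe.2 (mem_product.2 ⟨mem_product.2 ⟨?_, mem_product.2 ⟨?_, ?_⟩⟩, ?_⟩)
      · exact mem_filter.2 ⟨mem_univ _, hp'.1⟩
      · exact mem_filter.2 ⟨mem_univ _, hp'.2.1⟩
      · exact mem_filter.2 ⟨mem_univ _, hp'.2.2⟩
      · rw [Fintype.mem_piFinset]
        intro w
        simp only [enc, vals]
        by_cases h1 : w ∈ P
        · simp [h1]
        · by_cases h2 : w ∈ Q
          · by_cases h3 : w ∈ p.1 <;> by_cases h4 : w ∈ p.2 <;> simp [h1, h2, h3, h4]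
          · simp [h1, h2]
    · rintro ⟨A, B⟩ - ⟨A', B'⟩ - heq
      simp only [Prod.mk.injEq] at heq
      obtain ⟨⟨e1, e2, e3⟩, e4⟩ := heq
      have key : ∀ w, (w ∈ A ↔ w ∈ A') ∧ (w ∈ B ↔ w ∈ B') := by
        intro w
        have f1 : w ∈ A ∩ P ↔ w ∈ A' ∩ P := by rw [e1]
        have f2 : w ∈ B ∩ P ↔ w ∈ B' ∩ P := by rw [e2]
        have f3 : w ∈ A ∩ B ∩ Q ↔ w ∈ A' ∩ B' ∩ Q := by rw [e3]
        have f4 := congrFun e4 w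
        simp only [mem_inter] at f1 f2 f3
        simp only [enc] at f4
        by_cases h1 : w ∈ P
        · tauto
        · by_cases h2 : w ∈ Q
          · by_cases h3 : w ∈ A <;> by_cases h4 : w ∈ B <;> by_cases h5 : w ∈ A' <;>
              by_cases h6 : w ∈ B' <;> simp_all
          · simp only [h1, h2, if_false, false_and, Prod.mk.injEq, decide_eq_decide] at f4
            exact f4
      rw [Prod.mk.injEq]
      exact ⟨ext fun w => (key w).1, ext fun w => (key w).2⟩
  refine hle.trans ?_
  rw [card_product, card_product, card_product, hcard]
  refine Nat.mul_le_mul_right _ ?_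
  have := card_filter_card_le (V := V) k
  calc #S * (#S * #S) ≤ (Fintype.card V + 1) ^ k * ((Fintype.card V + 1) ^ k *
        (Fintype.card V + 1) ^ k) := by gcongr
    _ = _ := by rw [← pow_add, ← pow_add]; congr 1; ring

end Structure

/-! ### Extending a graph by two adjacent vertices -/

section Extension

variable {V W : Type*} [Fintype V] [Fintype W]

/-- `G` has a nice partition into `r` parts, with parameters given by powers of `L`. -/
def HasNice (G : SimpleGraph V) (r L : ℕ) : Prop :=
  ∃ c : V → Fin r, IsNice G c ⌈(Fintype.card V : ℝ) / L ^ 4⌉₊ ((Fintype.card V : ℝ) / L ^ 2)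
    ((Fintype.card V : ℝ) ^ 2 / L ^ 10)

/-- The number of `K_{r+1}`-free graphs without a nice partition. -/
noncomputable def numNotNice (V : Type*) [Fintype V] (r L : ℕ) : ℕ :=
  Nat.card {G : SimpleGraph V // G.CliqueFree (r + 1) ∧ ¬ HasNice G r L}

lemma numNotNice_eq (r L : ℕ) :
    numNotNice V r L = #{G : SimpleGraph V | G.CliqueFree (r + 1) ∧ ¬ HasNice G r L} := by
  rw [numNotNice, Nat.card_eq_fintype_card, Fintype.card_subtype]

/-- The subgraph away from `x` and `y` together with the neighbourhoods of `x` and `y`. -/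
noncomputable def splitTwo (φ : W ↪ V) (x y : V) (G : SimpleGraph V) :
    SimpleGraph W × Finset W × Finset W :=
  (G.comap φ, univ.filter fun w => G.Adj x (φ w), univ.filter fun w => G.Adj y (φ w))

/-- The pair xy is the only one that `splitTwo` does not record, and it is known to be an edge. -/
lemma splitTwo_injOn {V W : Type*} [Fintype W] (φ : W ↪ V) (x y : V) (hcover : ∀ v, v = x ∨ v = y ∨ ∃ w, φ w = v) :
    Set.InjOn (splitTwo φ x y) {G | G.Adj x y} := by
  have key : ∀ G H : SimpleGraph V, G.Adj x y → H.Adj x y →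
      splitTwo φ x y G = splitTwo φ x y H → G ≤ H := by
    intro G H hG hH h
    simp only [splitTwo, Prod.mk.injEq] at h
    obtain ⟨h1, h2, h3⟩ := h
    have hx : ∀ w, G.Adj x (φ w) → H.Adj x (φ w) := fun w hw => by
      have : w ∈ ({w | G.Adj x (φ w)} : Finset W) := by simpa using hw
      rw [h2] at this
      simpa using this
    have hy : ∀ w, G.Adj y (φ w) → H.Adj y (φ w) := fun w hw => by
      have : w ∈ ({w | G.Adj y (φ w)} : Finset W) := by simpa using hw
      rw [h3] at this
      simpa using this
    have hw : ∀ w w', G.Adj (φ w) (φ w') → H.Adj (φ w) (φ w') := fun w w' hww => by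
      have : (G.comap φ).Adj w w' := hww
      rw [h1] at this
      exact this
    intro u v huv
    rcases hcover u with rfl | rfl | ⟨w, rfl⟩ <;> rcases hcover v with rfl | rfl | ⟨w', rfl⟩
    · exact (huv.ne rfl).elim
    · exact hH
    · exact hx _ huv
    · exact hH.symm
    · exact (huv.ne rfl).elim
    · exact hy _ huv
    · exact (hx _ huv.symm).symm
    · exact (hy _ huv.symm).symm
    · exact hw _ _ huv
  intro G hG H hH h
  exact le_antisymm (key G H hG hH h) (key H G hH hG h.symm)

/-- From 3^5 ≤ 2^8. With a near n/r, the saving 12a/5 exceeds the 2a = 2n/r already given up by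
r-partite graphs, and the surplus 2a/5 drives the recursion. -/
lemma three_pow_mul_four_pow_le {n p q : ℕ} (h : p + q ≤ n) {a : ℝ} (hp : a ≤ p) (hq : a ≤ q) :
    (3 : ℝ) ^ q * 4 ^ (n - p - q) ≤ 2 ^ (2 * (n : ℝ) - 12 / 5 * a) := by
  have h3 : (3 : ℝ) ≤ 2 ^ (8 / 5 : ℝ) := by
    have h5 : (3 : ℝ) ^ (5 : ℕ) ≤ (2 ^ (8 / 5 : ℝ)) ^ (5 : ℕ) := by
      rw [← Real.rpow_natCast (2 ^ (8 / 5 : ℝ)) 5, ← Real.rpow_mul (by norm_num)]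
      norm_num
    exact le_of_pow_le_pow_left₀ (by norm_num) (by positivity) h5
  have h4 : (4 : ℝ) = 2 ^ (2 : ℝ) := by norm_num
  have hsub : ((n - p - q : ℕ) : ℝ) = n - p - q := by
    rw [Nat.sub_sub, Nat.cast_sub h]
    push_cast
    ring
  calc (3 : ℝ) ^ q * 4 ^ (n - p - q) ≤ (2 ^ (8 / 5 : ℝ)) ^ q * (2 ^ (2 : ℝ)) ^ (n - p - q) := by
        rw [← h4]
        gcongr
    _ = 2 ^ (8 / 5 * (q : ℝ) + 2 * ((n - p - q : ℕ) : ℝ)) := by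
        rw [← Real.rpow_natCast, ← Real.rpow_natCast, ← Real.rpow_mul (by norm_num),
          ← Real.rpow_mul (by norm_num), ← Real.rpow_add (by norm_num)]
    _ ≤ _ := by
        refine Real.rpow_le_rpow_of_exponent_le (by norm_num) ?_
        rw [hsub]
        linarith

/-- Counting the pairs of neighbourhoods that two adjacent vertices of the same type can have. -/
lemma card_biUnion_pairs_le {r k : ℕ} (c : W → Fin r) {a : ℝ}
    (ha : ∀ i, a ≤ #(colorClass c i)) :
    (#((univ.filter fun ij : Fin r × Fin r => ij.1 ≠ ij.2).biUnion fun ij =>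
      {p : Finset W × Finset W | #(p.1 ∩ colorClass c ij.1) ≤ k ∧ #(p.2 ∩ colorClass c ij.1) ≤ k ∧
        #(p.1 ∩ p.2 ∩ colorClass c ij.2) ≤ k}) : ℝ) ≤
      (r : ℝ) ^ 2 * (((Fintype.card W : ℝ) + 1) ^ (3 * k) *
        2 ^ (2 * (Fintype.card W : ℝ) - 12 / 5 * a)) := by
  have hone : ∀ ij ∈ univ.filter fun ij : Fin r × Fin r => ij.1 ≠ ij.2,
      (#{p : Finset W × Finset W | #(p.1 ∩ colorClass c ij.1) ≤ k ∧
        #(p.2 ∩ colorClass c ij.1) ≤ k ∧ #(p.1 ∩ p.2 ∩ colorClass c ij.2) ≤ k} : ℝ) ≤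
      ((Fintype.card W : ℝ) + 1) ^ (3 * k) * 2 ^ (2 * (Fintype.card W : ℝ) - 12 / 5 * a) := by
    intro ij hij
    have hdisj : Disjoint (colorClass c ij.1) (colorClass c ij.2) := by
      rw [disjoint_left]
      intro w h1 h2
      exact (mem_filter.1 hij).2 ((mem_colorClass.1 h1).symm.trans (mem_colorClass.1 h2))
    have h1 := card_filter_pairs_le _ _ hdisj k
    have h2 : #(colorClass c ij.1) + #(colorClass c ij.2) ≤ Fintype.card W := by
      rw [← card_union_of_disjoint hdisj]
      exact card_le_univ _
    have h3 := three_pow_mul_four_pow_le h2 (ha ij.1) (ha ij.2)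
    refine le_trans (Nat.cast_le.2 h1) ?_
    push_cast
    exact mul_le_mul_of_nonneg_left h3 (by positivity)
  refine le_trans (Nat.cast_le.2 card_biUnion_le) ?_
  push_cast
  refine (sum_le_sum hone).trans ?_
  rw [sum_const, nsmul_eq_mul]
  refine mul_le_mul_of_nonneg_right ?_ (by positivity)
  have : #(univ.filter fun ij : Fin r × Fin r => ij.1 ≠ ij.2) ≤ r ^ 2 := by
    refine (card_filter_le _ _).trans (le_of_eq ?_)
    rw [card_univ, Fintype.card_prod, Fintype.card_fin, sq]
  exact_mod_cast this

/-- Counting the clique-free graphs with a nice partition and an edge `xy` whose ends have few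
neighbours in a common part. -/
lemma card_filter_adj_le {r L : ℕ} (φ : W ↪ V) (x y : V)
    (hcover : ∀ v, v = x ∨ v = y ∨ ∃ w, φ w = v) (hVW : Fintype.card W ≤ Fintype.card V)
    (hd : (Fintype.card V : ℝ) ^ 2 / L ^ 10 ≤ 2 * ((Fintype.card W : ℝ) ^ 2 / L ^ 10))
    (hb : (r : ℝ) * ⌈(Fintype.card W : ℝ) / L ^ 4⌉₊ ≤
      Fintype.card W / r - Fintype.card W / L ^ 2) :
    (#{G : SimpleGraph V | G.CliqueFree (r + 1) ∧ G.Adj x y ∧ ∃ (c : V → Fin r) (i : Fin r),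
      IsNice G c ⌈(Fintype.card V : ℝ) / L ^ 4⌉₊ ((Fintype.card V : ℝ) / L ^ 2)
        ((Fintype.card V : ℝ) ^ 2 / L ^ 10) ∧
      #(nbrsIn G x (colorClass c i)) < ⌈(Fintype.card V : ℝ) / L ^ 4⌉₊ ∧
      #(nbrsIn G y (colorClass c i)) < ⌈(Fintype.card V : ℝ) / L ^ 4⌉₊} : ℝ) ≤
      numNotNice W r L * (2 ^ Fintype.card W * 2 ^ Fintype.card W) +
      numCliqueFree W (r + 1) * ((r : ℝ) ^ 2 * (((Fintype.card W : ℝ) + 1) ^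
        (3 * (2 * r * ⌈(Fintype.card V : ℝ) / L ^ 4⌉₊)) *
        2 ^ (2 * (Fintype.card W : ℝ) - 12 / 5 * (Fintype.card W / r - Fintype.card W / L ^ 2)))) := by
  set bV : ℕ := ⌈(Fintype.card V : ℝ) / L ^ 4⌉₊ with hbV
  set bW : ℕ := ⌈(Fintype.card W : ℝ) / L ^ 4⌉₊ with hbW
  have hbWV : bW ≤ bV := Nat.ceil_le_ceil (by gcongr)
  set 𝓑 : Finset (SimpleGraph V) := {G : SimpleGraph V | G.CliqueFree (r + 1) ∧ G.Adj x y ∧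
    ∃ (c : V → Fin r) (i : Fin r),
      IsNice G c bV ((Fintype.card V : ℝ) / L ^ 2) ((Fintype.card V : ℝ) ^ 2 / L ^ 10) ∧
      #(nbrsIn G x (colorClass c i)) < bV ∧ #(nbrsIn G y (colorClass c i)) < bV} with h𝓑
  have hcf : ∀ G ∈ 𝓑, (G.comap φ).CliqueFree (r + 1) := fun G hG =>
    SimpleGraph.CliqueFree.comap ⟨(SimpleGraph.Embedding.comap φ G).toCopy⟩ (mem_filter.1 hG).2.1
  have hinj : Set.InjOn (splitTwo φ x y) 𝓑 := fun G hG H hH h =>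
    splitTwo_injOn φ x y hcover (mem_filter.1 (mem_coe.1 hG)).2.2.1
      (mem_filter.1 (mem_coe.1 hH)).2.2.1 h
  have h1 : #{G ∈ 𝓑 | ¬ HasNice (G.comap φ) r L} ≤
      numNotNice W r L * (2 ^ Fintype.card W * 2 ^ Fintype.card W) := by
    rw [numNotNice_eq, ← Fintype.card_finset, ← Fintype.card_prod, ← card_univ, ← card_product]
    refine card_le_card_of_injOn (splitTwo φ x y) ?_
      (hinj.mono fun G hG => mem_coe.2 (mem_filter.1 (mem_coe.1 hG)).1)
    intro G hG
    have hG' := mem_filter.1 (mem_coe.1 hG)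
    exact mem_coe.2 (mem_product.2 ⟨mem_filter.2 ⟨mem_univ _, hcf G hG'.1, hG'.2⟩, mem_univ _⟩)
  set K : ℝ := (r : ℝ) ^ 2 * (((Fintype.card W : ℝ) + 1) ^ (3 * (2 * r * bV)) *
    2 ^ (2 * (Fintype.card W : ℝ) - 12 / 5 * (Fintype.card W / r - Fintype.card W / L ^ 2))) with hK
  have h2 : (#{G ∈ 𝓑 | HasNice (G.comap φ) r L} : ℝ) ≤ numCliqueFree W (r + 1) * K := by
    have hmaps : ∀ G ∈ ({G ∈ 𝓑 | HasNice (G.comap φ) r L} : Finset (SimpleGraph V)),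
        G.comap φ ∈ ({H : SimpleGraph W | H.CliqueFree (r + 1)} : Finset (SimpleGraph W)) :=
      fun G hG => mem_filter.2 ⟨mem_univ _, hcf G (mem_filter.1 hG).1⟩
    rw [numCliqueFree_eq, card_eq_sum_card_fiberwise hmaps, ← nsmul_eq_mul]
    push_cast
    refine sum_le_card_nsmul _ _ _ fun H hH => ?_
    by_cases hnice : HasNice H r L
    swap
    · have : ({G ∈ ({G ∈ 𝓑 | HasNice (G.comap φ) r L} : Finset (SimpleGraph V)) |
          G.comap φ = H} : Finset (SimpleGraph V)) = ∅ := by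
        refine filter_eq_empty_iff.2 fun G hG h => hnice ?_
        rw [← h]
        exact (mem_filter.1 hG).2
      rw [this, card_empty, Nat.cast_zero]
      positivity
    -- This c depends only on H, so all extensions of H are counted against one partition, although
    -- each G comes with its own c'.
    obtain ⟨c, hc⟩ := hnice
    refine le_trans (Nat.cast_le.2 ?_) (card_biUnion_pairs_le (k := 2 * r * bV) c hc.le_card)
    have hclass : ∀ i, r * bW ≤ #(colorClass c i) := fun i => by
      have := hb.trans (hc.le_card i)
      exact_mod_cast this
    refine card_le_card_of_injOn (fun G => (splitTwo φ x y G).2) ?_ ?_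
    · intro G hG
      obtain ⟨hG1, hGH⟩ := mem_filter.1 (mem_coe.1 hG)
      obtain ⟨-, hfree, hxy, c', i', hc', hx, hy⟩ := mem_filter.1 (mem_filter.1 hG1).1
      -- The restriction of c' has at most as many monochromatic pairs as G allows on V, which is
      -- within twice the allowance on W; this is the use of the factor 2 in `IsNice.lt_card`. So c'
      -- and c agree up to few vertices per class.
      obtain ⟨k, hk, hkcard⟩ := hc.exists_bijective hclass (fun w => c' (φ w)) (by
        refine le_trans ?_ (hc'.mono_le.trans hd)
        refine Nat.cast_le.2 (card_le_card_of_injOn (fun p => (φ p.1, φ p.2)) ?_ ?_)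
        · intro p hp
          simp only [coe_filter, mem_univ, true_and, Set.mem_ofPred_eq] at hp ⊢
          rw [← hGH] at hp
          exact hp
        · intro p _ p' _ h
          simp only [Prod.mk.injEq, EmbeddingLike.apply_eq_iff_eq] at h
          exact Prod.ext h.1 h.2)
      obtain ⟨i, rfl⟩ := hk.2 i'
      have hr : 0 < r := i.pos
      rw [← hGH] at hc
      obtain ⟨j, hij, hj⟩ := hc.exists_card_inter_lt
        (fun i => le_trans (Nat.le_mul_of_pos_left _ hr) (hclass i)) hfree hxy i
      have hsmall : ∀ z, #(nbrsIn G z (colorClass c' (k i))) < bV →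
          #(({w | G.Adj z (φ w)} : Finset W) ∩ colorClass c i) ≤ 2 * r * bV := by
        intro z hz
        have hsub : ({w | G.Adj z (φ w)} : Finset W) ∩ colorClass c i ⊆
            ({w | φ w ∈ nbrsIn G z (colorClass c' (k i))} : Finset W) ∪
              {w ∈ colorClass c i | c' (φ w) ≠ k i} := by
          intro w hw
          rw [mem_inter, mem_filter] at hw
          by_cases h : c' (φ w) = k i
          · refine mem_union_left _ (mem_filter.2 ⟨mem_univ _, ?_⟩)
            exact mem_nbrsIn.2 ⟨mem_colorClass.2 h, hw.1.2⟩
          · exact mem_union_right _ (mem_filter.2 ⟨hw.2, h⟩)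
        have hc1 : #({w | φ w ∈ nbrsIn G z (colorClass c' (k i))} : Finset W) ≤
            #(nbrsIn G z (colorClass c' (k i))) :=
          card_le_card_of_injOn φ (fun w hw => (mem_filter.1 (mem_coe.1 hw)).2)
            φ.injective.injOn
        have hc2 := (card_le_card hsub).trans (card_union_le _ _)
        have hc3 : #{w ∈ colorClass c i | c' (φ w) ≠ k i} ≤ r * bW := hkcard i
        have hc4 : r * bW ≤ r * bV := Nat.mul_le_mul_left _ hbWV
        have hc5 : bV ≤ r * bV := Nat.le_mul_of_pos_left _ hr
        have hc6 : 2 * r * bV = r * bV + r * bV := by ring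
        omega
      refine mem_coe.2 (mem_biUnion.2 ⟨(i, j), mem_filter.2 ⟨mem_univ _, hij⟩,
        mem_filter.2 ⟨mem_univ _, hsmall x hx, hsmall y hy, ?_⟩⟩)
      have hsub : (splitTwo φ x y G).2.1 ∩ (splitTwo φ x y G).2.2 ∩ colorClass c j ⊆
          {w ∈ colorClass c j | G.Adj x (φ w) ∧ G.Adj y (φ w)} := by
        intro w hw
        simp only [splitTwo, mem_inter, mem_filter, mem_univ, true_and] at hw ⊢
        exact ⟨hw.2, hw.1⟩
      have hc2 := card_le_card hsub
      have hc5 : bV ≤ r * bV := Nat.le_mul_of_pos_left _ hr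
      have hc6 : 2 * r * bV = r * bV + r * bV := by ring
      exact hc2.trans (by omega)
    · intro G hG G' hG' h
      obtain ⟨hG1, hGH⟩ := mem_filter.1 (mem_coe.1 hG)
      obtain ⟨hG1', hGH'⟩ := mem_filter.1 (mem_coe.1 hG')
      refine hinj (mem_coe.2 (mem_filter.1 hG1).1) (mem_coe.2 (mem_filter.1 hG1').1)
        (Prod.ext ?_ h)
      exact hGH.trans hGH'.symm
  have hsplit : #𝓑 = #{G ∈ 𝓑 | HasNice (G.comap φ) r L} +
      #{G ∈ 𝓑 | ¬ HasNice (G.comap φ) r L} :=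
    (card_filter_add_card_filter_not _).symm
  have h1' : (#{G ∈ 𝓑 | ¬ HasNice (G.comap φ) r L} : ℝ) ≤
      numNotNice W r L * (2 ^ Fintype.card W * 2 ^ Fintype.card W) := by exact_mod_cast h1
  rw [hsplit]
  push_cast
  linarith

end Extension

/-! ### Growth of the number of r-colourable graphs -/

section Colorable

/-- The number of `r`-colourable graphs on `V`. -/
noncomputable def numColorable (V : Type*) (r : ℕ) : ℕ :=
  Nat.card {G : SimpleGraph V // G.Colorable r}

/-- The number of `K_{r+1}`-free graphs on `V` that are not `r`-colourable. -/
noncomputable def numNonColorable (V : Type*) (r : ℕ) : ℕ :=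
  Nat.card {G : SimpleGraph V // G.CliqueFree (r + 1) ∧ ¬ G.Colorable r}

lemma numColorable_congr {V W : Type*} (e : V ≃ W) (r : ℕ) :
    numColorable V r = numColorable W r := by
  refine Nat.card_congr (e.simpleGraph.subtypeEquiv fun G => ?_)
  have i : G ≃g e.simpleGraph G := (SimpleGraph.Iso.comap e.symm G).symm
  exact ⟨fun h => h.of_hom i.symm.toHom, fun h => h.of_hom i.toHom⟩

lemma numCliqueFree_congr {V W : Type*} (e : V ≃ W) (s : ℕ) :
    numCliqueFree V s = numCliqueFree W s := by
  refine Nat.card_congr (e.simpleGraph.subtypeEquiv fun G => ?_)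
  have i : G ≃g e.simpleGraph G := (SimpleGraph.Iso.comap e.symm G).symm
  exact ⟨fun h => h.comap ⟨i.symm.toEmbedding.toCopy⟩, fun h => h.comap ⟨i.toEmbedding.toCopy⟩⟩

variable {V : Type*}

/-- The graph obtained from `G` by adding a vertex with neighbourhood `A`. -/
def addVertex (G : SimpleGraph V) (A : Finset V) : SimpleGraph (Option V) where
  Adj
    | some x, some y => G.Adj x y
    | some x, none => x ∈ A
    | none, some y => y ∈ A
    | none, none => False
  symm := ⟨fun u v h => by
    cases u <;> cases v <;> first | exact h | exact G.symm.symm _ _ h⟩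
  loopless := ⟨fun u h => by
    cases u
    exacts [h, G.irrefl h]⟩

lemma addVertex_injective {G H : SimpleGraph V} {A B : Finset V}
    (h : addVertex G A = addVertex H B) : G = H ∧ A = B := by
  constructor
  · ext x y
    have : (addVertex G A).Adj (some x) (some y) ↔ (addVertex H B).Adj (some x) (some y) := by
      rw [h]
    exact this
  · ext x
    have : (addVertex G A).Adj (some x) none ↔ (addVertex H B).Adj (some x) none := by rw [h]
    exact this

variable [Fintype V]

lemma numColorable_eq (r : ℕ) : numColorable V r = #{G : SimpleGraph V | G.Colorable r} := by
  rw [numColorable, Nat.card_eq_fintype_card, Fintype.card_subtype]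

lemma numNonColorable_eq (r : ℕ) : numNonColorable V r =
    #{G : SimpleGraph V | G.CliqueFree (r + 1) ∧ ¬ G.Colorable r} := by
  rw [numNonColorable, Nat.card_eq_fintype_card, Fintype.card_subtype]

lemma numCliqueFree_eq_add (r : ℕ) :
    numCliqueFree V (r + 1) = numColorable V r + numNonColorable V r := by
  rw [numCliqueFree_eq, numColorable_eq, numNonColorable_eq,
    ← card_filter_add_card_filter_not (fun G : SimpleGraph V => G.Colorable r), filter_filter,
    filter_filter]
  congr 2
  refine filter_congr fun G _ => ⟨fun h => h.2, fun h => ⟨h.cliqueFree (Nat.lt_succ_self r), h⟩⟩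

lemma card_le_numColorable {α : Type*} {r : ℕ} (s : Finset α) (f : α → SimpleGraph V)
    (hf : ∀ a ∈ s, (f a).Colorable r) (hinj : Set.InjOn f s) : #s ≤ numColorable V r := by
  rw [numColorable_eq]
  exact card_le_card_of_injOn f
    (fun a ha => mem_coe.2 (mem_filter.2 ⟨mem_univ _, hf a (mem_coe.1 ha)⟩)) hinj

/-- Fix one colouring of each colourable graph and put the new vertex in a class of at most average
size. It may be joined to any subset of the complement, and distinct pairs of graph and subset give
distinct graphs. -/
lemma mul_numColorable_le {r : ℕ} (hr : 1 ≤ r) :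
    2 ^ ((1 - 1 / (r : ℝ)) * Fintype.card V) * (numColorable V r : ℝ) ≤
      numColorable (Option V) r := by
  have hr0 : (0 : ℝ) < r := by exact_mod_cast hr
  have hclass : ∀ G : SimpleGraph V, ∃ A : Finset V, G.Colorable r →
      (1 - 1 / (r : ℝ)) * Fintype.card V ≤ #A ∧
        ∀ B ⊆ A, (addVertex G B).Colorable r := by
    intro G
    by_cases hG : G.Colorable r
    swap
    · exact ⟨∅, fun h => (hG h).elim⟩
    obtain ⟨c⟩ := hG
    obtain ⟨i, -, hi⟩ : ∃ i ∈ (univ : Finset (Fin r)),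
        (#(colorClass (c : V → Fin r) i) : ℝ) ≤ Fintype.card V / r := by
      refine exists_le_of_sum_le ⟨⟨0, hr⟩, mem_univ _⟩ ?_
      rw [sum_card_colorClass, sum_const, card_univ, Fintype.card_fin, nsmul_eq_mul]
      exact le_of_eq (by field_simp)
    refine ⟨univ \ colorClass (c : V → Fin r) i, fun _ => ⟨?_, fun B hB => ?_⟩⟩
    · rw [card_sdiff_of_subset (subset_univ _), card_univ, Nat.cast_sub (card_le_univ _)]
      have : (1 - 1 / (r : ℝ)) * Fintype.card V = Fintype.card V - Fintype.card V / r := by ring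
      linarith
    · have hne : ∀ x ∈ B, c x ≠ i := fun x hx h =>
        (mem_sdiff.1 (hB hx)).2 (mem_colorClass.2 h)
      refine ⟨SimpleGraph.Coloring.mk (fun u => u.elim i c) fun {u v} huv => ?_⟩
      cases u <;> cases v
      · exact huv.elim
      · exact (hne _ huv).symm
      · exact hne _ huv
      · exact c.valid huv
  choose A hA using hclass
  have h1 : #(({G : SimpleGraph V | G.Colorable r} : Finset (SimpleGraph V)).sigma
      fun G => (A G).powerset) ≤ numColorable (Option V) r := by
    refine card_le_numColorable _ (fun p => addVertex p.1 p.2) ?_ ?_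
    · intro p hp
      rw [mem_sigma, mem_filter, mem_powerset] at hp
      exact (hA p.1 hp.1.2).2 _ hp.2
    · rintro ⟨G, B⟩ - ⟨H, B'⟩ - h
      obtain ⟨rfl, rfl⟩ := addVertex_injective h
      rfl
  rw [card_sigma] at h1
  refine le_trans ?_ (Nat.cast_le.2 h1)
  rw [numColorable_eq, mul_comm, ← nsmul_eq_mul]
  push_cast
  refine card_nsmul_le_sum _ _ _ fun G hG => ?_
  rw [card_powerset]
  push_cast
  rw [← Real.rpow_natCast]
  exact Real.rpow_le_rpow_of_exponent_le (by norm_num) (hA G (mem_filter.1 hG).2).1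

lemma mul_numColorable_fin_le {r : ℕ} (hr : 1 ≤ r) (m : ℕ) :
    2 ^ ((1 - 1 / (r : ℝ)) * m) * (numColorable (Fin m) r : ℝ) ≤ numColorable (Fin (m + 1)) r := by
  rw [numColorable_congr (finSuccEquiv m)]
  simpa using mul_numColorable_le (V := Fin m) hr

/-- Adding vertices one at a time gives the lower bound without constructing balanced partitions;
the loss m/2 is harmless against terms of order m²/L^11. -/
lemma rpow_le_numColorable_fin {r : ℕ} (hr : 1 ≤ r) (m : ℕ) :
    2 ^ ((1 - 1 / (r : ℝ)) * (m : ℝ) ^ 2 / 2 - m / 2) ≤ (numColorable (Fin m) r : ℝ) := by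
  have hr0 : 0 ≤ 1 / (r : ℝ) := by positivity
  induction m with
  | zero =>
    have : 0 < numColorable (Fin 0) r := by
      rw [numColorable_eq]
      exact card_pos.2 ⟨⊥, mem_filter.2 ⟨mem_univ _, SimpleGraph.Colorable.of_isEmpty r⟩⟩
    have h1 : (1 : ℝ) ≤ numColorable (Fin 0) r := by exact_mod_cast this
    simpa using h1
  | succ m ih =>
    refine le_trans ?_ (mul_numColorable_fin_le hr m)
    refine le_trans ?_ (mul_le_mul_of_nonneg_left ih (by positivity))
    rw [← Real.rpow_add (by norm_num)]
    refine Real.rpow_le_rpow_of_exponent_le (by norm_num) ?_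
    push_cast
    nlinarith

end Colorable

/-! ### The two-vertex recursion for the ratio of bad to r-partite graphs -/

section Recursion

variable {V : Type*} [Fintype V]

lemma numNotNice_le {r L : ℕ} (hr : 2 ≤ r) (hrL : r ≤ L) (hL : 100 ≤ L)
    (hm : Fintype.card V + 1 ≤ 2 ^ L) (hLm : L ^ (24 + 28 * r) ≤ Fintype.card V) :
    (numNotNice V r L : ℝ) ≤
      2 ^ ((1 - 1 / (r : ℝ)) * (Fintype.card V : ℝ) ^ 2 / 2 - (Fintype.card V : ℝ) ^ 2 / L ^ 11) := by
  rw [numNotNice_eq]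
  refine le_trans (Nat.cast_le.2 (card_le_card fun G hG => ?_))
    (card_filter_forall_not_isNice_le hr hrL hL hm hLm)
  obtain ⟨-, h1, h2⟩ := mem_filter.1 hG
  exact mem_filter.2 ⟨mem_univ _, h1, fun c hc => h2 ⟨c, hc⟩⟩

lemma card_subtype_ne_and_ne {x y : V} (hxy : x ≠ y) :
    Fintype.card {v // v ≠ x ∧ v ≠ y} + 2 = Fintype.card V := by
  rw [Fintype.card_subtype]
  have h : (univ.filter fun v : V => v ≠ x ∧ v ≠ y) = univ \ {x, y} := by
    ext v
    simp
  rw [h, card_sdiff_of_subset (subset_univ _), card_pair hxy, card_univ]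
  have : #({x, y} : Finset V) ≤ Fintype.card V := card_le_univ _
  rw [card_pair hxy] at this
  omega

/-- Bounding the number of non-partite clique-free graphs by removing two vertices. -/
lemma numNonColorable_le {r L m : ℕ} (hV : Fintype.card V = m + 2) (hr : 2 ≤ r) (hrL : r ≤ L)
    (hL : 100 ≤ L) (hm : m + 3 ≤ 2 ^ L) (hLm : L ^ (24 + 28 * r) ≤ m) :
    (numNonColorable V r : ℝ) ≤ numNotNice V r L + ((m : ℝ) + 2) ^ 2 *
      (2 ^ ((1 - 1 / (r : ℝ)) * (m : ℝ) ^ 2 / 2 - (m : ℝ) ^ 2 / L ^ 11) * (2 ^ m * 2 ^ m) +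
      numCliqueFree (Fin m) (r + 1) * ((r : ℝ) ^ 2 * (((m : ℝ) + 1) ^
        (3 * (2 * r * ⌈((m : ℝ) + 2) / L ^ 4⌉₊)) *
        2 ^ (2 * (m : ℝ) - 12 / 5 * (m / r - m / L ^ 2))))) := by
  have hL1 : (100 : ℝ) ≤ L := by exact_mod_cast hL
  have hL0 : (0 : ℝ) < L := by linarith
  have hLm' : (L : ℝ) ^ (24 + 28 * r) ≤ m := by exact_mod_cast hLm
  have hL4 : (L : ℝ) ^ 4 ≤ m := (pow_le_pow_right₀ (by linarith) (by omega)).trans hLm'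
  have hm5 : (100 : ℝ) ≤ m := hL1.trans ((le_self_pow₀ (by linarith) (by norm_num)).trans hL4)
  have hr0 : (0 : ℝ) < r := by exact_mod_cast (by omega : 0 < r)
  have hrL' : (r : ℝ) ≤ L := by exact_mod_cast hrL
  have hVr : (Fintype.card V : ℝ) = m + 2 := by rw [hV]; push_cast; ring
  set M : ℝ := 2 ^ ((1 - 1 / (r : ℝ)) * (m : ℝ) ^ 2 / 2 - (m : ℝ) ^ 2 / L ^ 11) * (2 ^ m * 2 ^ m) +
      numCliqueFree (Fin m) (r + 1) * ((r : ℝ) ^ 2 * (((m : ℝ) + 1) ^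
        (3 * (2 * r * ⌈((m : ℝ) + 2) / L ^ 4⌉₊)) *
        2 ^ (2 * (m : ℝ) - 12 / 5 * (m / r - m / L ^ 2)))) with hM
  have hM0 : 0 ≤ M := by positivity
  let 𝓑 : V × V → Finset (SimpleGraph V) := fun p =>
    {G : SimpleGraph V | G.CliqueFree (r + 1) ∧ G.Adj p.1 p.2 ∧ ∃ (c : V → Fin r) (i : Fin r),
      IsNice G c ⌈(Fintype.card V : ℝ) / L ^ 4⌉₊ ((Fintype.card V : ℝ) / L ^ 2)
        ((Fintype.card V : ℝ) ^ 2 / L ^ 10) ∧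
      #(nbrsIn G p.1 (colorClass c i)) < ⌈(Fintype.card V : ℝ) / L ^ 4⌉₊ ∧
      #(nbrsIn G p.2 (colorClass c i)) < ⌈(Fintype.card V : ℝ) / L ^ 4⌉₊}
  have h𝓑 : ∀ p, (#(𝓑 p) : ℝ) ≤ M := by
    rintro ⟨x, y⟩
    by_cases hxy : x = y
    · have : 𝓑 (x, y) = ∅ := filter_eq_empty_iff.2 fun G _ h => h.2.1.ne hxy
      rw [this]
      simpa using hM0
    have hW := card_subtype_ne_and_ne hxy
    have hWm : Fintype.card {v // v ≠ x ∧ v ≠ y} = m := by omega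
    have h1 := card_filter_adj_le (r := r) (L := L) (Function.Embedding.subtype fun v => v ≠ x ∧ v ≠ y)
      x y (fun v => by
        by_cases hvx : v = x
        · exact Or.inl hvx
        · by_cases hvy : v = y
          · exact Or.inr (Or.inl hvy)
          · exact Or.inr (Or.inr ⟨⟨v, hvx, hvy⟩, rfl⟩))
      (by omega)
      (by
        rw [hWm, hVr, ← mul_div_assoc]
        gcongr
        nlinarith)
      (by
        rw [hWm]
        have e1 : (⌈(m : ℝ) / L ^ 4⌉₊ : ℝ) ≤ 2 * (m / L ^ 4) := by
          have := (Nat.ceil_lt_add_one (by positivity : (0 : ℝ) ≤ m / L ^ 4)).le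
          have : 1 ≤ (m : ℝ) / L ^ 4 := by rw [le_div_iff₀ (by positivity)]; linarith
          linarith
        have e2 : (r : ℝ) * (2 * (m / L ^ 4)) ≤ m / L ^ 2 := by
          calc (r : ℝ) * (2 * (m / L ^ 4)) ≤ L * (2 * (m / L ^ 4)) := by gcongr
            _ = (2 / (L : ℝ)) * ((m : ℝ) / (L : ℝ) ^ 2) := by field_simp
            _ ≤ 1 * ((m : ℝ) / (L : ℝ) ^ 2) := by
              gcongr
              rw [div_le_one hL0]
              linarith
            _ = (m : ℝ) / (L : ℝ) ^ 2 := one_mul _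
        have e3 : 2 * ((m : ℝ) / L ^ 2) ≤ m / r := by
          calc 2 * ((m : ℝ) / L ^ 2) = (2 / (L : ℝ)) * ((m : ℝ) / (L : ℝ)) := by field_simp
            _ ≤ 1 * ((m : ℝ) / (L : ℝ)) := by
              gcongr
              rw [div_le_one hL0]
              linarith
            _ = (m : ℝ) / (L : ℝ) := one_mul _
            _ ≤ (m : ℝ) / (r : ℝ) := by gcongr
        have e4 : (r : ℝ) * ⌈(m : ℝ) / L ^ 4⌉₊ ≤ r * (2 * (m / L ^ 4)) := by gcongr
        linarith)
    refine h1.trans ?_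
    have h2 : numCliqueFree {v // v ≠ x ∧ v ≠ y} (r + 1) = numCliqueFree (Fin m) (r + 1) :=
      numCliqueFree_congr (Fintype.equivFinOfCardEq hWm) _
    have h3 := numNotNice_le (V := {v // v ≠ x ∧ v ≠ y}) hr hrL hL (by omega) (by omega)
    rw [hWm] at h3
    rw [h2, hWm, hVr, hM]
    gcongr
  have hsub : ({G : SimpleGraph V | G.CliqueFree (r + 1) ∧ ¬ G.Colorable r} : Finset _) ⊆
      ({G : SimpleGraph V | G.CliqueFree (r + 1) ∧ ¬ HasNice G r L} : Finset _) ∪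
        univ.biUnion 𝓑 := by
    intro G hG
    obtain ⟨-, hfree, hcol⟩ := mem_filter.1 hG
    by_cases hn : HasNice G r L
    · obtain ⟨c, hc⟩ := hn
      obtain ⟨x, y, i, hxy, hx, hy⟩ := hc.exists_adj hfree hcol
      exact mem_union_right _ (mem_biUnion.2 ⟨(x, y), mem_univ _,
        mem_filter.2 ⟨mem_univ _, hfree, hxy, c, i, hc, hx, hy⟩⟩)
    · exact mem_union_left _ (mem_filter.2 ⟨mem_univ _, hfree, hn⟩)
  rw [numNonColorable_eq, numNotNice_eq]
  have hu : (#(univ.biUnion 𝓑) : ℝ) ≤ ((m : ℝ) + 2) ^ 2 * M := by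
    refine le_trans (Nat.cast_le.2 card_biUnion_le) ?_
    push_cast
    refine (sum_le_sum fun p _ => h𝓑 p).trans (le_of_eq ?_)
    rw [sum_const, card_univ, Fintype.card_prod, nsmul_eq_mul]
    push_cast
    rw [hVr]
    ring
  have h4 : (#{G : SimpleGraph V | G.CliqueFree (r + 1) ∧ ¬ G.Colorable r} : ℝ) ≤
      #{G : SimpleGraph V | G.CliqueFree (r + 1) ∧ ¬ HasNice G r L} + #(univ.biUnion 𝓑) := by
    exact_mod_cast (card_le_card hsub).trans (card_union_le _ _)
  linarith

/-- Of the surplus (2/5)m/r, the choices of x, y, the two parts and the exceptional sets consume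
only small multiples of m/(1000r), so m/(4r) survives. -/
lemma extension_factor_le {r L m : ℕ} (hr : 2 ≤ r) (hrL : r ≤ L) (hL : 1000 ≤ L)
    (hm : m + 3 ≤ 2 ^ L) (hLm : L ^ 4 ≤ m) :
    ((m : ℝ) + 2) ^ 2 * ((r : ℝ) ^ 2 * (((m : ℝ) + 1) ^ (3 * (2 * r * ⌈((m : ℝ) + 2) / L ^ 4⌉₊)) *
        2 ^ (2 * (m : ℝ) - 12 / 5 * (m / r - m / L ^ 2)))) ≤
      2 ^ (2 * (1 - 1 / (r : ℝ)) * m - m / (4 * r)) := by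
  have hL1 : (1000 : ℝ) ≤ L := by exact_mod_cast hL
  have hL0 : (0 : ℝ) < L := by linarith
  have hL4 : (L : ℝ) ^ 4 ≤ m := by exact_mod_cast hLm
  have hm0 : (0 : ℝ) < m := lt_of_lt_of_le (by positivity) hL4
  have hr0 : (0 : ℝ) < r := by exact_mod_cast (by omega : 0 < r)
  have hrL' : (r : ℝ) ≤ L := by exact_mod_cast hrL
  set b : ℕ := ⌈((m : ℝ) + 2) / L ^ 4⌉₊ with hb
  have hL4' : (1000 : ℝ) ≤ (L : ℝ) ^ 4 := hL1.trans (le_self_pow₀ (by linarith) (by norm_num))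
  have hb1 : (b : ℝ) ≤ 3 * (m / L ^ 4) := by
    have h1 := (Nat.ceil_lt_add_one (by positivity : (0 : ℝ) ≤ ((m : ℝ) + 2) / L ^ 4)).le
    have h2 : 1 ≤ (m : ℝ) / L ^ 4 := by rw [le_div_iff₀ (by positivity)]; linarith
    have h3 : ((m : ℝ) + 2) / L ^ 4 = m / L ^ 4 + 2 / L ^ 4 := by ring
    have h4 : (2 : ℝ) / L ^ 4 ≤ 1 := by rw [div_le_one (by positivity)]; linarith
    linarith
  have hm2 : (m : ℝ) + 2 ≤ 2 ^ L := by
    have : m + 2 ≤ 2 ^ L := by omega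
    exact_mod_cast this
  have hm1 : (m : ℝ) + 1 ≤ 2 ^ L := by linarith
  have hr2 : (r : ℝ) ≤ 2 ^ L := by
    have := L.lt_two_pow_self
    have : r ≤ 2 ^ L := by omega
    exact_mod_cast this
  have step : ((m : ℝ) + 2) ^ 2 * ((r : ℝ) ^ 2 * (((m : ℝ) + 1) ^ (3 * (2 * r * b)) *
        2 ^ (2 * (m : ℝ) - 12 / 5 * (m / r - m / L ^ 2)))) ≤
      (2 ^ L) ^ 2 * ((2 ^ L) ^ 2 * ((2 ^ L) ^ (3 * (2 * r * b)) *
        2 ^ (2 * (m : ℝ) - 12 / 5 * (m / r - m / L ^ 2)))) := by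
    gcongr
  refine step.trans ?_
  rw [← pow_mul, ← pow_mul, ← Real.rpow_natCast 2 (L * 2),
    ← Real.rpow_natCast 2 (L * (3 * (2 * r * b))),
    ← Real.rpow_add (by norm_num), ← Real.rpow_add (by norm_num), ← Real.rpow_add (by norm_num)]
  refine Real.rpow_le_rpow_of_exponent_le (by norm_num) ?_
  push_cast
  have hmr : (m : ℝ) / L ≤ m / r := by gcongr
  have e1 : (m : ℝ) / L ^ 2 ≤ m / r / 1000 := by
    calc (m : ℝ) / L ^ 2 = m / L / L := by field_simp
      _ ≤ m / r / 1000 := by gcongr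
  have e2 : (L : ℝ) * (3 * (2 * r * b)) ≤ 18 * (m / L ^ 2) := by
    calc (L : ℝ) * (3 * (2 * r * b)) ≤ L * (3 * (2 * L * (3 * (m / L ^ 4)))) := by gcongr
      _ = 18 * (m / L ^ 2) := by field_simp; ring
  have e3 : (L : ℝ) ≤ m / r / 1000 := by
    refine le_trans ?_ e1
    rw [le_div_iff₀ (by positivity)]
    calc (L : ℝ) * L ^ 2 = (L : ℝ) ^ 3 := by ring
      _ ≤ (L : ℝ) ^ 4 := pow_le_pow_right₀ (by linarith) (by norm_num)
      _ ≤ (m : ℝ) := hL4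
  have e4 : 2 * (1 - 1 / (r : ℝ)) * m = 2 * m - 2 * (m / r) := by ring
  have e5 : (m : ℝ) / (4 * r) = m / r / 4 := by field_simp
  rw [e4, e5]
  have hpos : 0 ≤ (m : ℝ) / r := by positivity
  linarith

/-- The ratio of non-partite to partite clique-free graphs, recursively. -/
lemma numNonColorable_fin_le {r L m : ℕ} (hr : 2 ≤ r) (hrL : r ≤ L) (hL : 1000 ≤ L)
    (hm : m + 3 ≤ 2 ^ L) (hLm : L ^ (24 + 28 * r) ≤ m) :
    (numNonColorable (Fin (m + 2)) r : ℝ) / numColorable (Fin (m + 2)) r ≤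
      2 ^ (-((m : ℝ) / (4 * r))) *
        (2 + (numNonColorable (Fin m) r : ℝ) / numColorable (Fin m) r) := by
  have hL1 : (1000 : ℝ) ≤ L := by exact_mod_cast hL
  have hL0 : (0 : ℝ) < L := by linarith
  have hLm' : (L : ℝ) ^ (24 + 28 * r) ≤ m := by exact_mod_cast hLm
  have hr0 : (0 : ℝ) < r := by exact_mod_cast (by omega : 0 < r)
  have hr2 : (2 : ℝ) ≤ r := by exact_mod_cast hr
  have hL12 : (L : ℝ) ^ 12 ≤ m := (pow_le_pow_right₀ (by linarith) (by omega)).trans hLm'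
  have hm0 : (0 : ℝ) < m := lt_of_lt_of_le (by positivity) hL12
  have hLm1 : (L : ℝ) ≤ m := (le_self_pow₀ (by linarith) (by norm_num)).trans hL12
  have hLm4 : L ^ 4 ≤ m := (Nat.pow_le_pow_right (by omega) (by omega)).trans hLm
  have hmsq : 1000 * (m : ℝ) ≤ (m : ℝ) ^ 2 / L ^ 11 := by
    rw [le_div_iff₀ (by positivity)]
    have : 1000 * (L : ℝ) ^ 11 ≤ m := by
      refine le_trans ?_ hL12
      calc 1000 * (L : ℝ) ^ 11 ≤ (L : ℝ) * (L : ℝ) ^ 11 := by gcongr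
        _ = (L : ℝ) ^ 12 := by ring
    nlinarith
  set x : ℝ := (m : ℝ) / (4 * r) with hx
  have hxm : x ≤ m := by
    rw [hx]
    exact div_le_self hm0.le (by linarith)
  have hx0 : 0 ≤ x := by positivity
  set P₀ : ℝ := ((numColorable (Fin m) r : ℕ) : ℝ) with hP₀
  set P₂ : ℝ := ((numColorable (Fin (m + 2)) r : ℕ) : ℝ) with hP₂
  have hP₀low := rpow_le_numColorable_fin (by omega : 1 ≤ r) m
  have hP₂low := rpow_le_numColorable_fin (by omega : 1 ≤ r) (m + 2)
  have hP₀pos : 0 < P₀ := lt_of_lt_of_le (by positivity) hP₀low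
  have hP₂pos : 0 < P₂ := lt_of_lt_of_le (by positivity) hP₂low
  have hratio : 2 ^ (2 * (1 - 1 / (r : ℝ)) * m) * P₀ ≤ P₂ := by
    have h1 := mul_numColorable_fin_le (by omega : 1 ≤ r) m
    have h2 := mul_numColorable_fin_le (by omega : 1 ≤ r) (m + 1)
    have hinv : 1 / (r : ℝ) ≤ 1 := by rw [div_le_one hr0]; linarith
    have h3 : (2 : ℝ) ^ ((1 - 1 / (r : ℝ)) * m) ≤ 2 ^ ((1 - 1 / (r : ℝ)) * (m + 1 : ℕ)) := by
      refine Real.rpow_le_rpow_of_exponent_le (by norm_num) ?_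
      refine mul_le_mul_of_nonneg_left ?_ (by linarith)
      push_cast
      linarith
    calc 2 ^ (2 * (1 - 1 / (r : ℝ)) * m) * P₀ =
          2 ^ ((1 - 1 / (r : ℝ)) * m) * (2 ^ ((1 - 1 / (r : ℝ)) * m) * P₀) := by
          rw [← mul_assoc, ← Real.rpow_add (by norm_num)]
          congr 2
          ring
      _ ≤ 2 ^ ((1 - 1 / (r : ℝ)) * (m + 1 : ℕ)) * numColorable (Fin (m + 1)) r := by gcongr
      _ ≤ P₂ := h2
  have hP₀P₂ : P₀ ≤ P₂ := by
    refine le_trans ?_ hratio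
    refine le_mul_of_one_le_left hP₀pos.le (Real.one_le_rpow (by norm_num) ?_)
    have hinv : 1 / (r : ℝ) ≤ 1 := by rw [div_le_one hr0]; linarith
    have : 0 ≤ 1 - 1 / (r : ℝ) := by linarith
    positivity
  have hmain := numNonColorable_le (V := Fin (m + 2)) (Fintype.card_fin _) hr hrL (by omega) hm hLm
  have hNN := numNotNice_le (V := Fin (m + 2)) hr hrL (by omega : 100 ≤ L)
    (by rw [Fintype.card_fin]; omega) (by rw [Fintype.card_fin]; omega)
  rw [Fintype.card_fin] at hNN
  have hfac := extension_factor_le hr hrL hL hm hLm4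
  set E : ℝ := ((r : ℝ) ^ 2 * (((m : ℝ) + 1) ^ (3 * (2 * r * ⌈((m : ℝ) + 2) / L ^ 4⌉₊)) *
        2 ^ (2 * (m : ℝ) - 12 / 5 * (m / r - m / L ^ 2)))) with hE
  have hCF : (numCliqueFree (Fin m) (r + 1) : ℝ) = P₀ + numNonColorable (Fin m) r := by
    rw [numCliqueFree_eq_add]
    push_cast
    rfl
  -- The constant 2 in the recursion is 1/2 + 1/2 + 1: graphs that are not nice, graphs not nice
  -- after deletion of x and y, and extensions of r-colourable graphs. Extensions of bad graphs give
  -- the recursive term.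
  have t1 : (numNotNice (Fin (m + 2)) r L : ℝ) ≤ 2 ^ (-x) / 2 * P₂ := by
    refine hNN.trans (le_trans ?_ (mul_le_mul_of_nonneg_left hP₂low (by positivity)))
    have e : (2 : ℝ) ^ (-x) / 2 = 2 ^ (-x - 1) := by rw [Real.rpow_sub_one (by norm_num)]
    rw [e, ← Real.rpow_add (by norm_num)]
    refine Real.rpow_le_rpow_of_exponent_le (by norm_num) ?_
    have h1 : (m : ℝ) ^ 2 / L ^ 11 ≤ ((m + 2 : ℕ) : ℝ) ^ 2 / L ^ 11 := by
      gcongr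
      linarith
    have h2 : ((m + 2 : ℕ) : ℝ) = m + 2 := by push_cast; ring
    have h3 : ((m + 2 : ℕ) : ℝ) / 2 ≤ m := by rw [h2]; linarith
    linarith
  have t2 : ((m : ℝ) + 2) ^ 2 * (2 ^ ((1 - 1 / (r : ℝ)) * (m : ℝ) ^ 2 / 2 - (m : ℝ) ^ 2 / L ^ 11) *
      (2 ^ m * 2 ^ m)) ≤ 2 ^ (-x) / 2 * P₂ := by
    have hm2 : (m : ℝ) + 2 ≤ 2 ^ (L : ℝ) := by
      rw [Real.rpow_natCast]
      have : m + 2 ≤ 2 ^ L := by omega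
      exact_mod_cast this
    have e : (2 : ℝ) ^ (-x) / 2 = 2 ^ (-x - 1) := by rw [Real.rpow_sub_one (by norm_num)]
    refine le_trans ?_ (mul_le_mul_of_nonneg_left (hP₀low.trans hP₀P₂) (by positivity))
    rw [e, ← Real.rpow_add (by norm_num)]
    calc _ ≤ ((2 : ℝ) ^ (L : ℝ)) ^ 2 *
          (2 ^ ((1 - 1 / (r : ℝ)) * (m : ℝ) ^ 2 / 2 - (m : ℝ) ^ 2 / L ^ 11) *
          (2 ^ (m : ℝ) * 2 ^ (m : ℝ))) := by
          rw [Real.rpow_natCast 2 m]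
          gcongr
      _ = 2 ^ (2 * (L : ℝ) + ((1 - 1 / (r : ℝ)) * (m : ℝ) ^ 2 / 2 - (m : ℝ) ^ 2 / L ^ 11 +
          2 * m)) := by
          rw [sq, ← Real.rpow_add (by norm_num), ← Real.rpow_add (by norm_num),
            ← Real.rpow_add (by norm_num), ← Real.rpow_add (by norm_num)]
          congr 1
          ring
      _ ≤ _ := by
          refine Real.rpow_le_rpow_of_exponent_le (by norm_num) ?_
          linarith
  have t3 : ((m : ℝ) + 2) ^ 2 * (numCliqueFree (Fin m) (r + 1) * E) ≤
      2 ^ (-x) * (1 + (numNonColorable (Fin m) r : ℝ) / P₀) * P₂ := by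
    have h1 : (1 + (numNonColorable (Fin m) r : ℝ) / P₀) * P₀ = numCliqueFree (Fin m) (r + 1) := by
      rw [hCF]
      field_simp
    have hexp : (2 : ℝ) ^ (2 * (1 - 1 / (r : ℝ)) * m - x) =
        2 ^ (-x) * 2 ^ (2 * (1 - 1 / (r : ℝ)) * m) := by
      rw [← Real.rpow_add (by norm_num)]
      congr 1
      ring
    have h2 : ((m : ℝ) + 2) ^ 2 * ((numCliqueFree (Fin m) (r + 1) : ℝ) * E) ≤
        2 ^ (2 * (1 - 1 / (r : ℝ)) * m - x) * (numCliqueFree (Fin m) (r + 1) : ℝ) := by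
      rw [mul_left_comm, mul_comm]
      exact mul_le_mul_of_nonneg_right hfac (Nat.cast_nonneg _)
    refine h2.trans ?_
    rw [hexp, ← h1]
    calc (2 : ℝ) ^ (-x) * 2 ^ (2 * (1 - 1 / (r : ℝ)) * m) *
          ((1 + (numNonColorable (Fin m) r : ℝ) / P₀) * P₀) =
          2 ^ (-x) * (1 + (numNonColorable (Fin m) r : ℝ) / P₀) *
          (2 ^ (2 * (1 - 1 / (r : ℝ)) * m) * P₀) := by ring
      _ ≤ 2 ^ (-x) * (1 + (numNonColorable (Fin m) r : ℝ) / P₀) * P₂ := by gcongr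
  rw [div_le_iff₀ hP₂pos]
  refine hmain.trans ?_
  rw [mul_add]
  have : 2 ^ (-x) * (2 + (numNonColorable (Fin m) r : ℝ) / P₀) * P₂ =
      2 ^ (-x) / 2 * P₂ + (2 ^ (-x) / 2 * P₂ +
        2 ^ (-x) * (1 + (numNonColorable (Fin m) r : ℝ) / P₀) * P₂) := by ring
  rw [this]
  exact add_le_add t1 (add_le_add t2 t3)

end Recursion

/-! ### Iterating the recursion and choosing the parameters -/

section Limit

/-- The value 4q is stable because q(2 + 4q) ≤ 4q for q ≤ 1/2, while the initial value is damped by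
q at every step. -/
lemma le_of_two_step_recursion {β : ℕ → ℝ} {q : ℝ} {m₀ k : ℕ} (hq0 : 0 ≤ q) (hq : q ≤ 1 / 2)
    (h : ∀ j < k, β (m₀ + 2 * j + 2) ≤ q * (2 + β (m₀ + 2 * j))) :
    β (m₀ + 2 * k) ≤ 4 * q + q ^ k * β m₀ := by
  induction k with
  | zero => simpa using hq0
  | succ k ih =>
    have h1 := ih fun j hj => h j (by omega)
    have h2 := h k (by omega)
    have h3 : q * β (m₀ + 2 * k) ≤ q * (4 * q + q ^ k * β m₀) :=
      mul_le_mul_of_nonneg_left h1 hq0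
    have h4 : m₀ + 2 * (k + 1) = m₀ + 2 * k + 2 := by ring
    have h5 : q * (4 * q) ≤ q * 2 := mul_le_mul_of_nonneg_left (by linarith) hq0
    rw [h4, pow_succ]
    linarith

lemma numColorable_fin_pos {r : ℕ} (hr : 1 ≤ r) (m : ℕ) : (0 : ℝ) < numColorable (Fin m) r :=
  lt_of_lt_of_le (by positivity) (rpow_le_numColorable_fin hr m)

/-- Crude starting value for the recursion: the main terms of the bounds for clique-free and
colourable graphs cancel. -/
lemma ratio_le_rpow {r L m : ℕ} (hr : 1 ≤ r) (hrL : r ≤ L) (hL : 10 ≤ L) (hm : m + 1 ≤ 2 ^ L)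
    (hLm : L ^ (24 + 28 * r) ≤ m) :
    (numNonColorable (Fin m) r : ℝ) / numColorable (Fin m) r ≤
      2 ^ (3 * (m : ℝ) ^ 2 / L ^ 11 + m / 2) := by
  have h1 := card_cliqueFree_le (V := Fin m) hr hrL hL (by rwa [Fintype.card_fin])
    (by rwa [Fintype.card_fin])
  rw [Fintype.card_fin, numCliqueFree_eq_add] at h1
  push_cast at h1
  rw [div_le_iff₀ (numColorable_fin_pos hr m)]
  have h2 := mul_le_mul_of_nonneg_left (rpow_le_numColorable_fin hr m)
    (by positivity : (0 : ℝ) ≤ 2 ^ (3 * (m : ℝ) ^ 2 / L ^ 11 + m / 2))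
  rw [← Real.rpow_add (by norm_num)] at h2
  have h3 : 3 * (m : ℝ) ^ 2 / L ^ 11 + m / 2 + ((1 - 1 / (r : ℝ)) * (m : ℝ) ^ 2 / 2 - m / 2) =
      (1 - 1 / (r : ℝ)) * (m : ℝ) ^ 2 / 2 + 3 * (m : ℝ) ^ 2 / L ^ 11 := by ring
  rw [h3] at h2
  have h4 := numColorable_fin_pos hr m
  linarith

/-- An effective form of the main result. -/
lemma ratio_le {r L n : ℕ} (hr : 2 ≤ r) (hrL : r ≤ L) (hL : 1000 ≤ L) (hn : n + 3 ≤ 2 ^ L)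
    (hLn : 2 * L ^ (24 + 28 * r) ≤ n) :
    (numNonColorable (Fin n) r : ℝ) / numColorable (Fin n) r ≤ 5 / ((n : ℝ) + 3) := by
  have hL1 : (1000 : ℝ) ≤ L := by exact_mod_cast hL
  have hL0 : (0 : ℝ) < L := by linarith
  have hr0 : (0 : ℝ) < r := by exact_mod_cast (by omega : 0 < r)
  have hrL' : (r : ℝ) ≤ L := by exact_mod_cast hrL
  have hLn3 : (L : ℝ) ^ 3 ≤ n := by
    have h1 : L ^ 3 ≤ L ^ (24 + 28 * r) := Nat.pow_le_pow_right (by omega) (by omega)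
    have h2 : L ^ 3 ≤ n := by omega
    exact_mod_cast h2
  have hLL : 1000 * (L : ℝ) ^ 2 ≤ n := by
    refine le_trans ?_ hLn3
    rw [pow_succ (L : ℝ) 2, mul_comm]
    gcongr
  have hLL' : 1000 * (L : ℝ) ≤ (L : ℝ) ^ 2 := by
    rw [sq]
    gcongr
  have hn0 : (0 : ℝ) < n := by nlinarith
  -- Starting at m₀ ≥ n/2 keeps every factor at most 2^(-y) with y = n/(8r). Since k ≥ n/8, their
  -- product is at most 2^(-n²/(64r)), which defeats the crude initial ratio.
  set k := n / 4 with hk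
  obtain ⟨m₀, hm₀⟩ : ∃ m₀, n = m₀ + 2 * k := ⟨n - 2 * k, by omega⟩
  have hkn : (n : ℝ) / 8 ≤ k := by
    have h1 : n ≤ 8 * k := by
      have : 1000 ≤ n := by
        have : (1000 : ℝ) ≤ n := by nlinarith
        exact_mod_cast this
      omega
    have h2 : (n : ℝ) ≤ 8 * k := by exact_mod_cast h1
    linarith
  have hm₀n : (n : ℝ) / 2 ≤ m₀ := by
    have h1 : n ≤ 2 * m₀ := by omega
    have h2 : (n : ℝ) ≤ 2 * m₀ := by exact_mod_cast h1
    linarith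
  have hm₀n' : (m₀ : ℝ) ≤ n := by exact_mod_cast (by omega : m₀ ≤ n)
  set y : ℝ := (n : ℝ) / (8 * r) with hy
  have hyL : (L : ℝ) ≤ y := by
    rw [hy, le_div_iff₀ (by positivity)]
    nlinarith
  have hqL : (2 : ℝ) ^ (-y) ≤ 1 / ((n : ℝ) + 3) := by
    rw [Real.rpow_neg (by norm_num), ← one_div]
    refine one_div_le_one_div_of_le (by positivity) ?_
    refine le_trans ?_ (Real.rpow_le_rpow_of_exponent_le (by norm_num) hyL)
    rw [Real.rpow_natCast]
    exact_mod_cast hn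
  have hq0 : (0 : ℝ) ≤ 2 ^ (-y) := by positivity
  have hq : (2 : ℝ) ^ (-y) ≤ 1 / 2 := by
    refine hqL.trans (one_div_le_one_div_of_le (by norm_num) (by linarith))
  have hrec := le_of_two_step_recursion (k := k) (m₀ := m₀)
    (β := fun m => (numNonColorable (Fin m) r : ℝ) / numColorable (Fin m) r) hq0 hq
    (fun j hj => by
      refine (numNonColorable_fin_le hr hrL hL (by omega) (by omega)).trans ?_
      refine mul_le_mul_of_nonneg_right ?_ (by positivity)
      refine Real.rpow_le_rpow_of_exponent_le (by norm_num) (neg_le_neg ?_)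
      rw [hy, div_le_div_iff₀ (by positivity) (by positivity)]
      push_cast
      have : (0 : ℝ) ≤ j := Nat.cast_nonneg _
      nlinarith)
  rw [← hm₀] at hrec
  have hbase := ratio_le_rpow (by omega : 1 ≤ r) hrL (by omega) (by omega : m₀ + 1 ≤ 2 ^ L)
    (by omega)
  have hlast : ((2 : ℝ) ^ (-y)) ^ k * ((numNonColorable (Fin m₀) r : ℝ) / numColorable (Fin m₀) r) ≤
      2 ^ (-y) := by
    refine (mul_le_mul_of_nonneg_left hbase (by positivity)).trans ?_
    rw [← Real.rpow_natCast, ← Real.rpow_mul (by norm_num), ← Real.rpow_add (by norm_num)]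
    refine Real.rpow_le_rpow_of_exponent_le (by norm_num) ?_
    have h1 : y * (n / 8) ≤ y * k := mul_le_mul_of_nonneg_left hkn (by positivity)
    have h2 : 3 * (m₀ : ℝ) ^ 2 / L ^ 11 ≤ y * n / 100 := by
      have e1 : (m₀ : ℝ) ^ 2 ≤ (n : ℝ) ^ 2 := by gcongr
      have e2 : 3 * (m₀ : ℝ) ^ 2 / (L : ℝ) ^ 11 ≤ 3 * (n : ℝ) ^ 2 / (L : ℝ) ^ 3 := by
        gcongr
        · linarith
        · norm_num
      refine e2.trans ?_
      have e3 : y * n / 100 = (n : ℝ) ^ 2 / (800 * r) := by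
        rw [hy]
        field_simp
        norm_num
      rw [e3, div_le_div_iff₀ (by positivity) (by positivity)]
      have e4 : 2400 * (r : ℝ) ≤ (L : ℝ) ^ 3 := by nlinarith
      have e5 := mul_le_mul_of_nonneg_left e4 (sq_nonneg (n : ℝ))
      linarith
    have h3 : (m₀ : ℝ) / 2 ≤ y * n / 100 := by
      have : 100 ≤ y := by linarith
      nlinarith
    have h4 : y ≤ y * n / 100 := by
      have : 100 ≤ (n : ℝ) := by nlinarith
      have : 0 ≤ y := by positivity
      nlinarith
    nlinarith
  have : (5 : ℝ) / ((n : ℝ) + 3) = 5 * (1 / ((n : ℝ) + 3)) := by ring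
  rw [this]
  linarith

/-- Take L = ⌊log₂ n⌋ + 2, so that L ≤ (log n)². Then 2L^(24 + 28r) ≤ L^(60r) ≤ (log n)^(120r) ≤ n,
the last inequality being the hypothesis on r; this is where the constant 120 enters. -/
lemma eventually_parameters (r : ℕ → ℕ)
    (hr : ∀ᶠ n : ℕ in Filter.atTop,
      2 ≤ r n ∧ (r n : ℝ) ≤ Real.log (n : ℝ) / (120 * Real.log (Real.log (n : ℝ)))) :
    ∀ᶠ n : ℕ in Filter.atTop, ∃ L : ℕ, 2 ≤ r n ∧ r n ≤ L ∧ 1000 ≤ L ∧ n + 3 ≤ 2 ^ L ∧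
      2 * L ^ (24 + 28 * r n) ≤ n := by
  have hlog : Filter.Tendsto (fun n : ℕ => Real.log (n : ℝ)) Filter.atTop Filter.atTop :=
    Real.tendsto_log_atTop.comp tendsto_natCast_atTop_atTop
  filter_upwards [hr, hlog.eventually_ge_atTop 1000, Filter.eventually_ge_atTop 3]
    with n ⟨hr2, hrn⟩ hx hn3
  set x := Real.log (n : ℝ) with hxdef
  have hn0 : (0 : ℝ) < n := by exact_mod_cast (by omega : 0 < n)
  have hlogx : 1 ≤ Real.log x := by
    rw [Real.le_log_iff_exp_le (by linarith)]
    have := Real.exp_one_lt_d9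
    linarith
  have hrx : (r n : ℝ) * (120 * Real.log x) ≤ x := (le_div_iff₀ (by positivity)).1 hrn
  set L := Nat.log 2 n + 2 with hL
  have hnL : n + 3 ≤ 2 ^ L := by
    have := Nat.lt_pow_succ_log_self (b := 2) (by norm_num) n
    have h2 : 2 ^ L = 2 ^ (Nat.log 2 n).succ * 2 := by rw [hL, ← pow_succ]
    omega
  have hxL : x ≤ L := by
    have h1 : (n : ℝ) ≤ 2 ^ L := by exact_mod_cast (by omega : n ≤ 2 ^ L)
    have h2 : x ≤ Real.log (2 ^ L) := Real.log_le_log hn0 h1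
    rw [Real.log_pow] at h2
    have h3 : Real.log 2 ≤ 1 := by have := Real.log_two_lt_d9; linarith
    have h4 : (L : ℝ) * Real.log 2 ≤ L * 1 := mul_le_mul_of_nonneg_left h3 (Nat.cast_nonneg _)
    linarith
  have hLx : (L : ℝ) ≤ x ^ 2 := by
    have h1 : ((2 : ℝ) ^ Nat.log 2 n) ≤ n := by exact_mod_cast Nat.pow_log_le_self 2 (by omega)
    have h2 := Real.log_le_log (by positivity) h1
    rw [Real.log_pow] at h2
    have h3 : 1 / 2 ≤ Real.log 2 := by have := Real.log_two_gt_d9; linarith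
    have h4 : (Nat.log 2 n : ℝ) * (1 / 2) ≤ Nat.log 2 n * Real.log 2 :=
      mul_le_mul_of_nonneg_left h3 (Nat.cast_nonneg _)
    rw [hL]
    push_cast
    nlinarith
  have hL1000 : 1000 ≤ L := by
    have : (1000 : ℝ) ≤ L := by linarith
    exact_mod_cast this
  refine ⟨L, hr2, ?_, hL1000, hnL, ?_⟩
  · have : (r n : ℝ) ≤ L := by
      have : (r n : ℝ) * 1 ≤ r n * (120 * Real.log x) :=
        mul_le_mul_of_nonneg_left (by linarith) (Nat.cast_nonneg _)
      linarith
    exact_mod_cast this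
  · have h1 : (L : ℝ) ^ (60 * r n) ≤ n := by
      calc (L : ℝ) ^ (60 * r n) ≤ (x ^ 2) ^ (60 * r n) := by gcongr
        _ = Real.exp ((120 * r n : ℕ) * Real.log x) := by
          rw [← pow_mul, Real.exp_nat_mul, Real.exp_log (by linarith)]
          congr 1
          ring
        _ ≤ Real.exp x := by
          refine Real.exp_le_exp.2 ?_
          push_cast
          linarith
        _ = (n : ℝ) := Real.exp_log hn0
    have h2 : L ^ (60 * r n) ≤ n := by exact_mod_cast h1
    refine le_trans ?_ h2
    calc 2 * L ^ (24 + 28 * r n) ≤ L * L ^ (24 + 28 * r n) := Nat.mul_le_mul_right _ (by omega)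
      _ = L ^ (25 + 28 * r n) := by rw [← pow_succ']; congr 1; omega
      _ ≤ L ^ (60 * r n) := Nat.pow_le_pow_right (by omega) (by omega)

end Limit

end Development

theorem theorem1p2 (r : ℕ → ℕ)
    (hr : ∀ᶠ n : ℕ in Filter.atTop,
      2 ≤ r n ∧ (r n : ℝ) ≤ Real.log (n : ℝ) / (120 * Real.log (Real.log (n : ℝ)))) :
    Filter.Tendsto
      (fun n : ℕ =>
        ((nonPartiteCliqueFreeGraphs n (r n)).ncard : ℝ) /
          ((cliqueFreeGraphs n (r n)).ncard : ℝ))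
      Filter.atTop (nhds 0) := by
  have hlim : Filter.Tendsto (fun n : ℕ => 5 / ((n : ℝ) + 3)) Filter.atTop (nhds 0) :=
    (Filter.tendsto_atTop_add_const_right _ _ tendsto_natCast_atTop_atTop).const_div_atTop 5
  refine tendsto_of_tendsto_of_tendsto_of_le_of_le' tendsto_const_nhds hlim
    (Filter.Eventually.of_forall fun n => by positivity) ?_
  filter_upwards [eventually_parameters r hr] with n ⟨L, hr2, hrL, hL, hn, hLn⟩
  refine le_trans ?_ (ratio_le hr2 hrL hL hn hLn)
  have h1 : (nonPartiteCliqueFreeGraphs n (r n)).ncard = numNonColorable (Fin n) (r n) :=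
    (Nat.card_coe_set_eq _).symm
  have h2 : (cliqueFreeGraphs n (r n)).ncard = numCliqueFree (Fin n) (r n + 1) :=
    (Nat.card_coe_set_eq _).symm
  -- The clique-free graphs include the r-colourable ones, so replacing the denominator by the
  -- latter only increases the ratio.
  rw [h1, h2, numCliqueFree_eq_add]
  refine div_le_div_of_nonneg_left (Nat.cast_nonneg _) (numColorable_fin_pos (by omega) n) ?_
  exact_mod_cast Nat.le_add_right _ _
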